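/- Let $G$ be a connected (finite-dimensional, real) Lie group with Lie algebra $\mathfrak g$, let $K$ be an $\mathrm{Ad}$-invariant nondegenerate symmetric bilinear form on $\mathfrak g$, also regarded as an isomorphism $\mathfrak g\to\mathfrak g^*$, $x\mapsto K(x,\cdot)$, and let $\sigma$ be a smooth involutive automorphism of $G$ whose differential, again denoted $\sigma:\mathfrak g\to\mathfrak g$, is orthogonal for $K$. Let $D=G\times G$, with the form $\langle (x,y),(x',y')\rangle=K(x,x')-K(y,y')$ on $\mathfrak d=\mathfrak g\oplus\mathfrak g$. Put $G_+=\{(g,g)\}$, $G_+^\sigma=\{(g,\sigma(g))\}$ with Lie algebra $\mathfrak g_+^\sigma$, and $\mathfrak g_-^\sigma=\{(x,-\sigma(x)) : x\in\mathfrak g\}$. Identify $G_+^\sigma$ with $G$ through $g\mapsto(g,\sigma(g))$. Then $(D,G_+^\sigma,\mathfrak g_-^\sigma)$ is a quasi-triple: $D$ is connected with $\langle\,,\rangle$ invariant, symmetric and nondegenerate, $G_+^\sigma$ is a connected closed subgroup, and $\mathfrak d=\mathfrak g_+^\sigma\oplus\mathfrak g_-^\sigma$ with both summands isotropic. Let $j:(\mathfrak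 g_+^\sigma)^*\to\mathfrak g_-^\sigma$ be the isomorphism with $\langle j(\xi),x\rangle=\xi(x)$, let $r:\mathfrak d^*\to\mathfrak d$ be $r(\alpha)=j(\alpha|_{\mathfrak g_+^\sigma})$, viewed as an element of $\mathfrak d\otimes\mathfrak d$, and let $P_D^\sigma=r^\lambda-r^\rho$ be the difference of the left- and right-invariant tensor fields generated by $r$; it is a bivector field on $D$. Let $\varphi(\xi,\eta,\nu)=\nu(p_{\mathfrak g_+^\sigma}[j\xi,j\eta])$, and let $F(x)\in\bigwedge^2\mathfrak g_+^\sigma$, for $x\in\mathfrak g_+^\sigma$, be given by $F(x)(\xi,\eta)=\langle p_{\mathfrak g_-^\sigma}[j\xi,j\eta],x\rangle$. Identify $S=D/G_+$ with $G$ through $(a,b)\mapsto ab^{-1}$. A bivector $P$ is also seen as a map $T^*\to T$ by $P(\alpha,\beta)=\beta(P(\alpha))$. 1. The bivector field $P_D^\sigma$ projects to a (unique) bivector field $P_S^\sigma$ on $S$. Trivialising the tangent spaces of $S=G$ by right translations, for $s\in S$ and $\xi\in\mathfrak g^*\simeq T_s^*S$, $$P_S^\sigma(s)(\xi)=\tfrac12\bigl(\mathrm{Ad}_{\sigma(s)^{-1}}-\mathrm{Ad}_s\bigr)\circ\sigma\circ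 K^{-1}(\xi).$$ 2. The action $(g,s)\mapsto g\,s\,\sigma(g)^{-1}$ of $G_+^\sigma\simeq G$ on $S$, which is induced by left multiplication on $D$, is quasi-Poisson on $(S,P_S^\sigma)$ in the sense of Alekseev and Kosmann-Schwarzbach, that is, $$\tfrac12[P_S^\sigma,P_S^\sigma]=\varphi_S,\qquad \mathcal L_{x_S}P_S^\sigma=(F(x))_S\quad\text{for all }x\in\mathfrak g_+^\sigma.$$ Here $x_S(s)=\frac{d}{dt}\big|_{t=0}\exp(tx)\cdot s$, the subscript $S$ also denotes the induced map from multivectors on $\mathfrak g_+^\sigma$ to multivector fields on $S$, and the Schouten bracket is normalised by $\tfrac12[P,P](df,dg,dh)=\{\{f,g\},h\}+\{\{g,h\},f\}+\{\{h,f\},g\}$ with $\{f,g\}=P(df,dg)$. 3. For every $s\in S$ the image of $P_S^\sigma(s):T_s^*S\to T_sS$ is contained in the tangent space at $s$ of the orbit of $s$ under this action of $G_+^\sigma$, that is, in $\{x_S(s) : x\in\mathfrak g_+^\sigma\}$. -/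

import Mathlib

open scoped Manifold ContDiff

noncomputable section

/-! ### Linear algebra of a splitting into two isotropic subspaces -/

section Splitting

variable {V W : Type*} [AddCommGroup V] [Module ℝ V] [AddCommGroup W] [Module ℝ W]

/-- `B` is a nondegenerate symmetric bilinear form on `V`, the map `i : W → V` is injective with
isotropic image, and `𝔥` is an isotropic complement of that image. (For finite-dimensional `V` this
forces `B` to have signature `(n, n)` with `n = dim W`.) -/
structure IsIsotropicSplitting (B : LinearMap.BilinForm ℝ V) (i : W →ₗ[ℝ] V)
    (𝔥 : Submodule ℝ V) : Prop where
  symm : B.IsSymm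
  nondegenerate : B.Nondegenerate
  injective : Function.Injective i
  isotropic_range : ∀ x y : W, B (i x) (i y) = 0
  isotropic_compl : ∀ x ∈ 𝔥, ∀ y ∈ 𝔥, B x y = 0
  isCompl : IsCompl (LinearMap.range i) 𝔥

/-- The pairing `y ↦ (x ↦ ⟨y, i x⟩)` from `𝔥` to the dual of `W`. -/
def complPairing (B : LinearMap.BilinForm ℝ V) (i : W →ₗ[ℝ] V) (𝔥 : Submodule ℝ V) :
    𝔥 →ₗ[ℝ] Module.Dual ℝ W :=
  (LinearMap.lcomp ℝ ℝ i).comp (LinearMap.comp B 𝔥.subtype)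

namespace IsIsotropicSplitting

variable {B : LinearMap.BilinForm ℝ V} {i : W →ₗ[ℝ] V} {𝔥 : Submodule ℝ V}

/-- The projection `V = i(W) ⊕ 𝔥 → W` onto the first summand, identified with `W` through `i`. -/
def projPlus (h : IsIsotropicSplitting B i 𝔥) : V →ₗ[ℝ] W :=
  (LinearEquiv.ofInjective i h.injective).symm.toLinearMap.comp
    (Submodule.projectionOnto (LinearMap.range i) 𝔥 h.isCompl)

/-- The projection `V = i(W) ⊕ 𝔥 → 𝔥` onto the second summand. -/
def projMinus (h : IsIsotropicSplitting B i 𝔥) : V →ₗ[ℝ] 𝔥 :=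
  Submodule.projectionOnto 𝔥 (LinearMap.range i) h.isCompl.symm

lemma projPlus_add_projMinus (h : IsIsotropicSplitting B i 𝔥) (v : V) :
    i (h.projPlus v) + h.projMinus v = v := by
  have h1 : i (h.projPlus v)
      = Submodule.projectionOnto (LinearMap.range i) 𝔥 h.isCompl v := by
    have := LinearEquiv.apply_symm_apply (LinearEquiv.ofInjective i h.injective)
      (Submodule.projectionOnto (LinearMap.range i) 𝔥 h.isCompl v)
    exact congrArg Subtype.val this
  rw [h1]
  exact Submodule.projection_add_projection_eq_self h.isCompl v

lemma projPlus_apply (h : IsIsotropicSplitting B i 𝔥) (x : W) : h.projPlus (i x) = x := by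
  apply h.injective
  have h1 := h.projPlus_add_projMinus (i x)
  have h2 : h.projMinus (i x) = 0 :=
    Submodule.projectionOnto_apply_of_mem_right h.isCompl.symm ⟨x, rfl⟩
  simpa [h2] using h1

lemma complPairing_bijective [FiniteDimensional ℝ V] (h : IsIsotropicSplitting B i 𝔥) :
    Function.Bijective (complPairing B i 𝔥) := by
  constructor
  · rw [← LinearMap.ker_eq_bot, LinearMap.ker_eq_bot']
    intro y hy
    have hy' : ∀ x, B y (i x) = 0 := fun x => LinearMap.congr_fun hy x
    apply Subtype.ext
    apply h.nondegenerate.1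
    intro v
    rw [← h.projPlus_add_projMinus v, map_add, hy',
      h.isotropic_compl _ y.2 _ (h.projMinus v).2, add_zero]
  · intro ξ
    refine ⟨h.projMinus ((B.toDual h.nondegenerate).symm (ξ.comp h.projPlus)), ?_⟩
    ext x
    set u := (B.toDual h.nondegenerate).symm (ξ.comp h.projPlus) with hu
    have h1 : B u (i x) = ξ x := by
      rw [hu, LinearMap.BilinForm.apply_toDual_symm_apply]
      simp [h.projPlus_apply]
    have h2 := h.projPlus_add_projMinus u
    rw [← h2, map_add, LinearMap.add_apply, h.isotropic_range, zero_add] at h1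
    exact h1

/-- The isomorphism `j : W* → 𝔥`, determined by `⟨j ξ, i x⟩ = ξ x`. -/
def j [FiniteDimensional ℝ V] (h : IsIsotropicSplitting B i 𝔥) : Module.Dual ℝ W ≃ₗ[ℝ] 𝔥 :=
  (LinearEquiv.ofBijective _ h.complPairing_bijective).symm

lemma j_spec [FiniteDimensional ℝ V] (h : IsIsotropicSplitting B i 𝔥) (ξ : Module.Dual ℝ W)
    (x : W) : B (h.j ξ) (i x) = ξ x :=
  LinearMap.congr_fun
    ((LinearEquiv.ofBijective _ h.complPairing_bijective).apply_symm_apply ξ) x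

/-- The `r`-matrix in `V ⊗ V`, seen as a map `V* → V`: it sends `α` to `j (α|_W)`. -/
def rMatrix [FiniteDimensional ℝ V] (h : IsIsotropicSplitting B i 𝔥) :
    Module.Dual ℝ V →ₗ[ℝ] V :=
  𝔥.subtype.comp (h.j.toLinearMap.comp (LinearMap.lcomp ℝ ℝ i))

end IsIsotropicSplitting

end Splitting

/-! ### Bivector fields on manifolds -/

section Bivector

variable {E H : Type*} [NormedAddCommGroup E] [NormedSpace ℝ E] [TopologicalSpace H]
  (J : ModelWithCorners ℝ E H) {M : Type*} [TopologicalSpace M] [ChartedSpace H M]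
  {E' H' : Type*} [NormedAddCommGroup E'] [NormedSpace ℝ E'] [TopologicalSpace H']
  (J' : ModelWithCorners ℝ E' H') {N : Type*} [TopologicalSpace N] [ChartedSpace H' N]

instance [FiniteDimensional ℝ E] (m : M) : FiniteDimensional ℝ (TangentSpace J m) :=
  inferInstanceAs (FiniteDimensional ℝ E)

variable (M) in
/-- A (not necessarily antisymmetric or smooth) field of contravariant 2-tensors on `M`, each seen
as a map `T*M → TM`; the corresponding bilinear form on covectors is `(α, β) ↦ β (P α)`. -/
abbrev TwoTensorField := ∀ m : M, Module.Dual ℝ (TangentSpace J m) →ₗ[ℝ] TangentSpace J m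

/-- The differential of a map between manifolds, as a linear map. -/
def tangentLin (f : M → N) (m : M) : TangentSpace J m →ₗ[ℝ] TangentSpace J' (f m) :=
  (mfderiv J J' f m).toLinearMap

/-- The differential of a real function, as a covector. -/
def covec (f : M → ℝ) (m : M) : Module.Dual ℝ (TangentSpace J m) :=
  (NormedSpace.fromTangentSpace (𝕜 := ℝ) (f m)).toLinearMap.comp (tangentLin J 𝓘(ℝ, ℝ) f m)

/-- The bracket `{f, g} = P(df, dg)` of two functions. -/
def tensorBracket (P : TwoTensorField J M) (f g : M → ℝ) (m : M) : ℝ :=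
  covec J g m (P m (covec J f m))

/-- `P` is a smooth bivector field. -/
structure IsBivectorField (P : TwoTensorField J M) : Prop where
  alternating : ∀ (m : M) (α : Module.Dual ℝ (TangentSpace J m)), α (P m α) = 0
  smooth : ∀ (U : Set M) (f g : M → ℝ), IsOpen U → ContMDiffOn J 𝓘(ℝ, ℝ) ∞ f U →
    ContMDiffOn J 𝓘(ℝ, ℝ) ∞ g U → ContMDiffOn J 𝓘(ℝ, ℝ) ∞ (tensorBracket J P f g) U

/-- The Schouten–Nijenhuis bracket `[P, Q]` of two bivector fields, as a tridifferential operator: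
its value `[P, Q](df, dg, dh)` is the sum over `(2, 1)`-shuffles of
`P(d Q(df, dg), dh) + Q(d P(df, dg), dh)`. -/
def schoutenBracket (P Q : TwoTensorField J M) (f g h : M → ℝ) (m : M) : ℝ :=
  (tensorBracket J P (tensorBracket J Q f g) h m
    + tensorBracket J P (tensorBracket J Q g h) f m
    + tensorBracket J P (tensorBracket J Q h f) g m)
  + (tensorBracket J Q (tensorBracket J P f g) h m
    + tensorBracket J Q (tensorBracket J P g h) f m
    + tensorBracket J Q (tensorBracket J P h f) g m)

/-- The derivative `X f` of a function along a vector field. -/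
def alongField (X : ∀ m : M, TangentSpace J m) (f : M → ℝ) (m : M) : ℝ := covec J f m (X m)

/-- The Lie derivative `L_X P`, evaluated on `df` and `dg`. -/
def lieDerivBivector (X : ∀ m : M, TangentSpace J m) (P : TwoTensorField J M)
    (f g : M → ℝ) (m : M) : ℝ :=
  alongField J X (tensorBracket J P f g) m - tensorBracket J P (alongField J X f) g m
    - tensorBracket J P f (alongField J X g) m

/-- The 2-tensor field `P` on `M` projects to the 2-tensor field `Q` on `N` along `q : M → N`. -/
def ProjectsTo (q : M → N) (P : TwoTensorField J M) (Q : TwoTensorField J' N) : Prop :=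
  ∀ (m : M) (β : Module.Dual ℝ (TangentSpace J' (q m))),
    Q (q m) β = tangentLin J J' q m (P m (β.comp (tangentLin J J' q m)))

end Bivector

/-! ### Lie groups and quasi-triples -/

section LieGroups

variable {E H : Type*} [NormedAddCommGroup E] [NormedSpace ℝ E] [TopologicalSpace H]
  (I : ModelWithCorners ℝ E H) {G : Type*} [TopologicalSpace G] [ChartedSpace H G] [Group G]
  {E' H' : Type*} [NormedAddCommGroup E'] [NormedSpace ℝ E'] [TopologicalSpace H']
  (I' : ModelWithCorners ℝ E' H') {D : Type*} [TopologicalSpace D] [ChartedSpace H' D] [Group D]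

/-- The adjoint action: the differential at `1` of conjugation by `g`. -/
def Ad (g : G) : GroupLieAlgebra I G →ₗ[ℝ] GroupLieAlgebra I G :=
  (mfderiv I I (fun h : G => g * h * g⁻¹) 1).toLinearMap

/-- The differential at `1` of a group morphism, as a map of Lie algebras. -/
def homDeriv (φ : G →* D) : GroupLieAlgebra I G →ₗ[ℝ] GroupLieAlgebra I' D :=
  (mfderiv I I' φ 1).toLinearMap

/-- The map `T_1 G → T_g G` given by the left translation by `g`. -/
def leftTriv (g : G) : GroupLieAlgebra I G →ₗ[ℝ] TangentSpace I g :=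
  (mfderiv I I (fun h : G => g * h) 1).toLinearMap

/-- The map `T_1 G → T_g G` given by the right translation by `g`. -/
def rightTriv (g : G) : GroupLieAlgebra I G →ₗ[ℝ] TangentSpace I g :=
  (mfderiv I I (fun h : G => h * g) 1).toLinearMap

/-- The left-invariant 2-tensor field `r^λ` generated by `r`. -/
def leftInvariantTensor (r : Module.Dual ℝ (GroupLieAlgebra I G) →ₗ[ℝ] GroupLieAlgebra I G) :
    TwoTensorField I G :=
  fun g => (leftTriv I g).comp (r.comp (LinearMap.lcomp ℝ ℝ (leftTriv I g)))

/-- The right-invariant 2-tensor field `r^ρ` generated by `r`. -/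
def rightInvariantTensor (r : Module.Dual ℝ (GroupLieAlgebra I G) →ₗ[ℝ] GroupLieAlgebra I G) :
    TwoTensorField I G :=
  fun g => (rightTriv I g).comp (r.comp (LinearMap.lcomp ℝ ℝ (rightTriv I g)))

/-- A quasi-triple `(D, G, 𝔥)`: a connected Lie group `D` whose Lie algebra carries an
`Ad`-invariant nondegenerate symmetric bilinear form `B`, a connected closed Lie subgroup `G`, given
as the image of `ι`, with isotropic Lie algebra, and an isotropic complement `𝔥` of that
Lie algebra. -/
structure IsQuasiTriple (B : LinearMap.BilinForm ℝ (GroupLieAlgebra I' D)) (ι : G →* D)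
    (𝔥 : Submodule ℝ (GroupLieAlgebra I' D)) : Prop where
  connected_group : ConnectedSpace D
  connected_subgroup : ConnectedSpace G
  smooth : ContMDiff I I' ∞ ι
  isClosedEmbedding : Topology.IsClosedEmbedding ι
  invariant : ∀ (d : D) (x y : GroupLieAlgebra I' D), B (Ad I' d x) (Ad I' d y) = B x y
  splitting : IsIsotropicSplitting B (homDeriv I I' ι) 𝔥

namespace IsQuasiTriple

variable {I I'} {B : LinearMap.BilinForm ℝ (GroupLieAlgebra I' D)} {ι : G →* D}
  {𝔥 : Submodule ℝ (GroupLieAlgebra I' D)} [FiniteDimensional ℝ E']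

/-- The 2-tensor field `P_D = r^λ - r^ρ` on `D` attached to a quasi-triple. -/
def bivector (hT : IsQuasiTriple I I' B ι 𝔥) : TwoTensorField I' D :=
  fun d => leftInvariantTensor I' hT.splitting.rMatrix d
    - rightInvariantTensor I' hT.splitting.rMatrix d

/-- The trivector `φ(ξ, η, ν) = ν (p_𝔤 [j ξ, j η])` on `𝔤`. -/
def phi (hT : IsQuasiTriple I I' B ι 𝔥) (ξ η ν : Module.Dual ℝ (GroupLieAlgebra I G)) : ℝ :=
  ν (hT.splitting.projPlus
    ⁅(hT.splitting.j ξ : GroupLieAlgebra I' D), (hT.splitting.j η : GroupLieAlgebra I' D)⁆)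

/-- The cobracket `F : 𝔤 → ⋀² 𝔤`, dual to `(ξ, η) ↦ p_𝔥 [j ξ, j η]` with `𝔥` identified with the
dual of `𝔤` through `j`. -/
def cobracket (hT : IsQuasiTriple I I' B ι 𝔥) (x : GroupLieAlgebra I G)
    (ξ η : Module.Dual ℝ (GroupLieAlgebra I G)) : ℝ :=
  hT.splitting.j.symm (hT.splitting.projMinus
    ⁅(hT.splitting.j ξ : GroupLieAlgebra I' D), (hT.splitting.j η : GroupLieAlgebra I' D)⁆) x

end IsQuasiTriple

variable {E₁ H₁ : Type*} [NormedAddCommGroup E₁] [NormedSpace ℝ E₁] [TopologicalSpace H₁]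
  (J : ModelWithCorners ℝ E₁ H₁) {M : Type*} [TopologicalSpace M] [ChartedSpace H₁ M]

/-- The infinitesimal action `𝔤 → T_m M`, `x ↦ d/dt (exp (t x) · m)` at `t = 0`: the differential
at `1` of the orbit map (recall that `Φ 1 m = m` for an action). -/
def infAction (Φ : G → M → M) (m : M) : GroupLieAlgebra I G →ₗ[ℝ] TangentSpace J m :=
  (mfderiv I J (fun g : G => Φ g m) 1).toLinearMap

/-- The smooth action `Φ` of the quasi-Poisson Lie group `G`, with structure given by a quasi-triple
`(D, G, 𝔥)`, on the manifold `M` with bivector field `P` is quasi-Poisson: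
`½ [P, P] = φ_M` and `L_{x_M} P = (F x)_M` for all `x` in the Lie algebra of `G`. Here `x_M` is the
vector field `m ↦ d/dt (exp (t x) · m)` at `t = 0`, and the subscript `M` denotes the induced
map on multivectors. -/
structure IsQuasiPoissonAction [FiniteDimensional ℝ E']
    {B : LinearMap.BilinForm ℝ (GroupLieAlgebra I' D)} {ι : G →* D}
    {𝔥 : Submodule ℝ (GroupLieAlgebra I' D)} (hT : IsQuasiTriple I I' B ι 𝔥)
    (Φ : G → M → M) (P : TwoTensorField J M) : Prop where
  one_act : ∀ m, Φ 1 m = m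
  mul_act : ∀ g h m, Φ (g * h) m = Φ g (Φ h m)
  smooth_act : ContMDiff (I.prod J) J ∞ (fun p : G × M => Φ p.1 p.2)
  isBivectorField : IsBivectorField J P
  schouten : ∀ (U : Set M) (f g h : M → ℝ), IsOpen U → ContMDiffOn J 𝓘(ℝ, ℝ) ∞ f U →
    ContMDiffOn J 𝓘(ℝ, ℝ) ∞ g U → ContMDiffOn J 𝓘(ℝ, ℝ) ∞ h U → ∀ m ∈ U,
    (1 / 2 : ℝ) * schoutenBracket J P P f g h m
      = hT.phi ((covec J f m).comp (infAction I J Φ m)) ((covec J g m).comp (infAction I J Φ m))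
        ((covec J h m).comp (infAction I J Φ m))
  lieDeriv : ∀ (x : GroupLieAlgebra I G) (U : Set M) (f g : M → ℝ), IsOpen U →
    ContMDiffOn J 𝓘(ℝ, ℝ) ∞ f U → ContMDiffOn J 𝓘(ℝ, ℝ) ∞ g U → ∀ m ∈ U,
    lieDerivBivector J (fun m => infAction I J Φ m x) P f g m
      = hT.cobracket x ((covec J f m).comp (infAction I J Φ m))
          ((covec J g m).comp (infAction I J Φ m))

/-- The map `q : D → M` realises the manifold `M` as the homogeneous space `D / A`: it is a smooth
surjective submersion whose fibres are the left cosets of `A`. -/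
structure IsQuotientBy (q : D → M) (A : Subgroup D) : Prop where
  smooth : ContMDiff I' J ∞ q
  surjective : Function.Surjective q
  submersion : ∀ d, Function.Surjective (tangentLin I' J q d)
  fibre : ∀ d d', q d = q d' ↔ d⁻¹ * d' ∈ A

end LieGroups

/-! ### The twisted quasi-triple on `G × G` -/

section Double

variable {E H : Type*} [NormedAddCommGroup E] [NormedSpace ℝ E] [TopologicalSpace H]
  (I : ModelWithCorners ℝ E H) {G : Type*} [TopologicalSpace G] [ChartedSpace H G] [Group G]

variable (G) in
/-- The first projection of the Lie algebra of `G × G`. -/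
def lieFst : GroupLieAlgebra (I.prod I) (G × G) →ₗ[ℝ] GroupLieAlgebra I G :=
  homDeriv (I.prod I) I (MonoidHom.fst G G)

variable (G) in
/-- The second projection of the Lie algebra of `G × G`. -/
def lieSnd : GroupLieAlgebra (I.prod I) (G × G) →ₗ[ℝ] GroupLieAlgebra I G :=
  homDeriv (I.prod I) I (MonoidHom.snd G G)

/-- The form `⟨(x, y), (x', y')⟩ = K(x, x') - K(y, y')` on the Lie algebra of `G × G`. -/
def doubleForm (K : LinearMap.BilinForm ℝ (GroupLieAlgebra I G)) :
    LinearMap.BilinForm ℝ (GroupLieAlgebra (I.prod I) (G × G)) :=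
  K.comp (lieFst I G) (lieFst I G) - K.comp (lieSnd I G) (lieSnd I G)

/-- The morphism `g ↦ (g, σ g)` from `G` to `G × G`, whose image is `G_+^σ`; for `σ = id` the image
is the diagonal `G_+`. -/
def twistedDiag (σ : G →* G) : G →* G × G := (MonoidHom.id G).prod σ

/-- The map `Δ_-^σ : x ↦ (x, -σ x)` from `𝔤` to `𝔤 ⊕ 𝔤`. -/
def twistedAntidiag (σ : G →* G) :
    GroupLieAlgebra I G →ₗ[ℝ] GroupLieAlgebra (I.prod I) (G × G) :=
  homDeriv I (I.prod I) (MonoidHom.inl G G)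
    - (homDeriv I (I.prod I) (MonoidHom.inr G G)).comp (homDeriv I I σ)

/-- The subspace `𝔤_-^σ`, the image of `Δ_-^σ`. -/
def gMinus (σ : G →* G) : Submodule ℝ (GroupLieAlgebra (I.prod I) (G × G)) :=
  LinearMap.range (twistedAntidiag I σ)

end Double

end

/-! Everything is computed on the model space `E` of 𝔤, with tangent spaces of G trivialised by
right translations. Put A = Ad_s ∘ σ. It is a K-orthogonal Lie algebra automorphism, with inverse
A⁻¹ = σ ∘ Ad_{s⁻¹} = Ad_{σ(s)⁻¹} ∘ σ. In these terms P_S(s) ∘ K is ½(A⁻¹ − A), and the infinitesimal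
action at s is x ↦ x − A x.

Splitting. Since σ is an orthogonal involution, the graphs of σ and −σ are complementary and
isotropic. Moreover j(K a) = ½(a, −σ a), so brackets of elements of 𝔤_-^σ fall in 𝔤_+^σ. Hence F = 0
and φ(K a, K b, K c) = ¼ K(c, [a, b]) (`lie_j_twisted`).

Projection. P_D is alternating because ⟨u, p_- u⟩ = ½⟨u, u⟩: the symmetric part of r is Ad-invariant
and cancels in r^λ − r^ρ. A covector pulled back from S and moved to the identity by left
translation is represented by a diagonal vector (c, c). Its projection p_-(c, c) = ½(c − σ c, c − σ
c) is again diagonal, hence tangent to the fibre, so r^λ contributes nothing on S. What r^ρ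
contributes depends only on s = a b⁻¹ and equals ½(A⁻¹ − A) (`projMinus_twisted_sub`).

Quasi-Poisson identities. If a, b are the K-gradients of f, g, then {f, g} = ½(K(A b, a) − K(A a,
b)). Along v the operator A has derivative ad_v ∘ A, because the differential of Ad is ad
(`dOne_adModel`). The derivatives of the gradients are Hessians which need not be symmetric; their
antisymmetric part is −K([x, y], a), by the commutator of right-invariant fields (`rightHess_sub`).
In both the Jacobi sum and the Lie derivative the Hessians enter only through that part. What
remains are two trilinear identities, consequences of the invariance of K and of the orthogonality
of A (`schouten_identity`, `lie_identity`).

Orbits. ½(A⁻¹ − A) a = x − A x for x = ½(a + A⁻¹ a). -/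

noncomputable section

/-! ### Derivatives at the identity, read in a chart. -/

section DerivAtOne

open Filter Topology

variable {E H : Type*} [NormedAddCommGroup E] [NormedSpace ℝ E] [TopologicalSpace H]
  (I : ModelWithCorners ℝ E H) {G : Type*} [TopologicalSpace G]
  [ChartedSpace H G] [Group G]
  {E' H' : Type*} [NormedAddCommGroup E'] [NormedSpace ℝ E'] [TopologicalSpace H']
  (I' : ModelWithCorners ℝ E' H') {D : Type*} [TopologicalSpace D]
  [ChartedSpace H' D] [Group D]
  {V : Type*} [NormedAddCommGroup V] [NormedSpace ℝ V]

/-- The inverse of the preferred chart at the identity. -/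
def chartInv (G : Type*) [TopologicalSpace G] [ChartedSpace H G] [Group G] (z : E) : G :=
  (extChartAt I (1 : G)).symm z

/-- The coordinates of the identity. -/
def chartOne (G : Type*) [TopologicalSpace G] [ChartedSpace H G] [Group G] : E :=
  extChartAt I (1 : G) 1

/-- The derivative at the identity of a vector-valued function, in the preferred chart. -/
def dOne (f : G → V) : E →L[ℝ] V :=
  fderiv ℝ (fun z => f (chartInv I G z)) (chartOne I G)

lemma chartInv_chartOne : chartInv I G (chartOne I G) = 1 :=
  extChartAt_to_inv (I := I) (1 : G)

lemma chartOne_target_mem_nhds [I.Boundaryless] : (extChartAt I (1 : G)).target ∈ 𝓝 (chartOne I G) :=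
  extChartAt_target_mem_nhds (I := I) (1 : G)

lemma contMDiffAt_chartInv [I.Boundaryless] [IsManifold I ∞ G] {z : E} (hz : z ∈ (extChartAt I (1 : G)).target) :
    ContMDiffAt 𝓘(ℝ, E) I ∞ (chartInv I G) z :=
  (contMDiffOn_extChartAt_symm (I := I) (n := ∞) (1 : G)).contMDiffAt
    ((isOpen_extChartAt_target (I := I) (1 : G)).mem_nhds hz)

lemma contMDiffAt_chartInv_one [I.Boundaryless] [IsManifold I ∞ G] :
    ContMDiffAt 𝓘(ℝ, E) I ∞ (chartInv I G) (chartOne I G) :=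
  contMDiffAt_chartInv I (mem_of_mem_nhds (chartOne_target_mem_nhds I))

lemma continuousAt_chartInv : ContinuousAt (chartInv I G) (chartOne I G) :=
  continuousAt_extChartAt_symm (I := I) (1 : G)

variable {I I'}

lemma contDiffAt_comp_chartInv [I.Boundaryless] [IsManifold I ∞ G] {f : G → V}
    (hf : ContMDiffAt I 𝓘(ℝ, V) ∞ f 1) :
    ContDiffAt ℝ ∞ (fun z => f (chartInv I G z)) (chartOne I G) := by
  rw [← contMDiffAt_iff_contDiffAt]
  have h : ContMDiffAt I 𝓘(ℝ, V) ∞ f (chartInv I G (chartOne I G)) := by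
    rwa [chartInv_chartOne]
  exact h.comp _ (contMDiffAt_chartInv_one I)

lemma differentiableAt_comp_chartInv [I.Boundaryless] [IsManifold I ∞ G] {f : G → V}
    (hf : ContMDiffAt I 𝓘(ℝ, V) ∞ f 1) :
    DifferentiableAt ℝ (fun z => f (chartInv I G z)) (chartOne I G) :=
  (contDiffAt_comp_chartInv hf).differentiableAt (by simp)

lemma hasFDerivAt_comp_chartInv [I.Boundaryless] [IsManifold I ∞ G] {f : G → V}
    (hf : ContMDiffAt I 𝓘(ℝ, V) ∞ f 1) :
    HasFDerivAt (fun z => f (chartInv I G z)) (dOne I f) (chartOne I G) :=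
  (differentiableAt_comp_chartInv hf).hasFDerivAt

lemma mfderiv_one_eq_dOne [I.Boundaryless] {f : G → V} (hf : MDifferentiableAt I 𝓘(ℝ, V) f 1) :
    mfderiv I 𝓘(ℝ, V) f 1 = dOne I f := by
  rw [hf.mfderiv]
  simp only [writtenInExtChartAt, I.range_eq_univ, fderivWithin_univ, extChartAt_model_space_eq_id,
    PartialEquiv.refl_coe]
  rfl

lemma dOne_congr {f g : G → V} (h : f =ᶠ[𝓝 1] g) : dOne I f = dOne I g := by
  apply Filter.EventuallyEq.fderiv_eq
  have := (continuousAt_chartInv (G := G) I).tendsto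
  rw [chartInv_chartOne] at this
  exact this.eventually h

/-- The chain rule for a map preserving the identity. -/
lemma dOne_comp [I.Boundaryless] [I'.Boundaryless] [IsManifold I ∞ G]
    [IsManifold I' ∞ D] {f : D → V} {ψ : G → D} (h1 : ψ 1 = 1)
    (hf : ContMDiffAt I' 𝓘(ℝ, V) ∞ f 1) (hψ : ContMDiffAt I I' ∞ ψ 1) (v : E) :
    dOne I (fun g => f (ψ g)) v = dOne I' f (mfderiv I I' ψ 1 v) := by
  have hf' : MDifferentiableAt I' 𝓘(ℝ, V) f (ψ 1) := by
    rw [h1]; exact hf.mdifferentiableAt (by simp)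
  have hψ' : MDifferentiableAt I I' ψ 1 := hψ.mdifferentiableAt (by simp)
  have := mfderiv_comp (1 : G) hf' hψ'
  have h2 : mfderiv I' 𝓘(ℝ, V) f (ψ 1) = dOne I' f := by
    rw [h1]; exact mfderiv_one_eq_dOne (hf.mdifferentiableAt (by simp))
  have h3 := mfderiv_one_eq_dOne (hf'.comp (1 : G) hψ')
  exact (DFunLike.congr_fun h3 v).symm.trans ((DFunLike.congr_fun this v).trans
    (DFunLike.congr_fun h2 _))

/-- Derivatives at the identity depend smoothly on parameters. -/
lemma contMDiffAt_dOne [I.Boundaryless] [IsManifold I ∞ G]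
    {E₁ H₁ : Type*} [NormedAddCommGroup E₁] [NormedSpace ℝ E₁] [TopologicalSpace H₁]
    {J : ModelWithCorners ℝ E₁ H₁} {M : Type*} [TopologicalSpace M] [ChartedSpace H₁ M]
    [IsManifold J ∞ M] {F : M → G → V} {m : M}
    (hF : ContMDiffAt (J.prod I) 𝓘(ℝ, V) ∞ (Function.uncurry F) (m, 1)) :
    ContMDiffAt J 𝓘(ℝ, E →L[ℝ] V) ∞ (fun m => dOne I (F m)) m := by
  have h1 : ContMDiffAt (J.prod 𝓘(ℝ, E)) 𝓘(ℝ, V) ∞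
      (Function.uncurry fun (m : M) (z : E) => F m (chartInv I G z)) (m, chartOne I G) := by
    have h2 : ContMDiffAt (J.prod I) 𝓘(ℝ, V) ∞ (Function.uncurry F)
      (m, chartInv I G (chartOne I G)) := by rwa [chartInv_chartOne]
    have h3 : ContMDiffAt (J.prod 𝓘(ℝ, E)) (J.prod I) ∞
        (fun p : M × E => (p.1, chartInv I G p.2)) (m, chartOne I G) :=
      contMDiffAt_fst.prodMk ((contMDiffAt_chartInv_one I).comp (m, chartOne I G) contMDiffAt_snd)
    exact ContMDiffAt.comp (m, chartOne I G) h2 h3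
  have h4 := ContMDiffAt.mfderiv (m := ∞) (fun (m : M) (z : E) => F m (chartInv I G z))
    (fun _ => chartOne I G) h1 contMDiffAt_const (by simp)
  -- Between vector spaces the tangent coordinate changes are trivial, so smoothness of the
  -- `mfderiv` family is smoothness of the plain derivative.
  have h5 := inTangentCoordinates_model_space (I := 𝓘(ℝ, E)) (I' := 𝓘(ℝ, V))
    (fun _ : M => chartOne I G) (fun m : M => F m (chartInv I G (chartOne I G)))
    (fun m => fderiv ℝ (fun z => F m (chartInv I G z)) (chartOne I G)) m
  simp only [mfderiv_eq_fderiv] at h4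
  exact (congrArg (fun q => ContMDiffAt J 𝓘(ℝ, E →L[ℝ] V) ∞ q m) h5).mp h4

/-- Symmetry of the mixed second derivatives. -/
lemma dOne_dOne_comm [I.Boundaryless] [I'.Boundaryless] [IsManifold I ∞ G]
    [IsManifold I' ∞ D] {F : G → D → V}
    (hF : ContMDiffAt (I.prod I') 𝓘(ℝ, V) ∞ (Function.uncurry F) (1, 1)) (v : E) (w : E') :
    dOne I (fun h => dOne I' (fun k => F h k) w) v
      = dOne I' (fun k => dOne I (fun h => F h k) v) w := by
  -- Both iterated derivatives are read off the second derivative of one function on `E × E'`, whose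
  -- symmetry is known.
  set c : E × E' := (chartOne I G, chartOne I' D) with hc
  set Φ : E × E' → V := fun p => F (chartInv I G p.1) (chartInv I' D p.2) with hΦ
  have hΦs : ContDiffAt ℝ ∞ Φ c := by
    rw [← contMDiffAt_iff_contDiffAt]
    have h2 : ContMDiffAt (I.prod I') 𝓘(ℝ, V) ∞ (Function.uncurry F)
      (chartInv I G (chartOne I G), chartInv I' D (chartOne I' D)) := by
        rwa [chartInv_chartOne, chartInv_chartOne]
    have h3 : ContMDiffAt 𝓘(ℝ, E × E') (I.prod I') ∞
        (fun p : E × E' => (chartInv I G p.1, chartInv I' D p.2)) c :=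
      ((contMDiffAt_chartInv_one I).comp c contDiffAt_fst.contMDiffAt).prodMk
        ((contMDiffAt_chartInv_one I').comp c contDiffAt_snd.contMDiffAt)
    exact ContMDiffAt.comp c h2 h3
  have hev : ∀ᶠ p in 𝓝 c, DifferentiableAt ℝ Φ p := by
    have := (hΦs.of_le (m := 1) (by simp)).eventually (by simp)
    filter_upwards [this] with p hp using hp.differentiableAt (by simp)
  have hd : DifferentiableAt ℝ (fderiv ℝ Φ) c :=
    (hΦs.fderiv_right (m := ∞) (by simp)).differentiableAt (by simp)
  have hL : dOne I (fun h => dOne I' (fun k => F h k) w) v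
      = fderiv ℝ (fderiv ℝ Φ) c (v, 0) (0, w) := by
    have hi : HasFDerivAt (fun x : E => ((x, chartOne I' D) : E × E'))
        (ContinuousLinearMap.inl ℝ E E') (chartOne I G) := by
      exact (hasFDerivAt_id _).prodMk (hasFDerivAt_const _ _)
    have h1 : (fun x => dOne I' (fun k => F (chartInv I G x) k) w) =ᶠ[𝓝 (chartOne I G)]
        fun x => fderiv ℝ Φ (x, chartOne I' D) (0, w) := by
      filter_upwards [hi.continuousAt.tendsto.eventually hev] with x hx
      have hj : HasFDerivAt (fun y : E' => ((x, y) : E × E'))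
        (ContinuousLinearMap.inr ℝ E E') (chartOne I' D) := by
        exact (hasFDerivAt_const _ _).prodMk (hasFDerivAt_id _)
      have := (hx.hasFDerivAt.comp _ hj).fderiv
      exact DFunLike.congr_fun this w
    have h2 : HasFDerivAt (fun x => fderiv ℝ Φ (x, chartOne I' D) (0, w))
        ((ContinuousLinearMap.apply ℝ V ((0, w) : E × E')).comp ((fderiv ℝ (fderiv ℝ Φ) c).comp
          (ContinuousLinearMap.inl ℝ E E'))) (chartOne I G) :=
      (ContinuousLinearMap.apply ℝ V ((0, w) : E × E')).hasFDerivAt.comp _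
        (hd.hasFDerivAt.comp (f := fun x : E => ((x, chartOne I' D) : E × E')) _ hi)
    exact DFunLike.congr_fun (h1.fderiv_eq.trans h2.fderiv) v
  have hR : dOne I' (fun k => dOne I (fun h => F h k) v) w
      = fderiv ℝ (fderiv ℝ Φ) c (0, w) (v, 0) := by
    have hi : HasFDerivAt (fun y : E' => ((chartOne I G, y) : E × E'))
        (ContinuousLinearMap.inr ℝ E E') (chartOne I' D) := by
      exact (hasFDerivAt_const _ _).prodMk (hasFDerivAt_id _)
    have h1 : (fun y => dOne I (fun h => F h (chartInv I' D y)) v) =ᶠ[𝓝 (chartOne I' D)]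
        fun y => fderiv ℝ Φ (chartOne I G, y) (v, 0) := by
      filter_upwards [hi.continuousAt.tendsto.eventually hev] with y hy
      have hj : HasFDerivAt (fun x : E => ((x, y) : E × E'))
        (ContinuousLinearMap.inl ℝ E E') (chartOne I G) := by
        exact (hasFDerivAt_id _).prodMk (hasFDerivAt_const _ _)
      have := (hy.hasFDerivAt.comp (f := fun x : E => ((x, y) : E × E')) _ hj).fderiv
      exact DFunLike.congr_fun this v
    have h2 : HasFDerivAt (fun y => fderiv ℝ Φ (chartOne I G, y) (v, 0))
        ((ContinuousLinearMap.apply ℝ V ((v, 0) : E × E')).comp ((fderiv ℝ (fderiv ℝ Φ) c).comp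
          (ContinuousLinearMap.inr ℝ E E'))) (chartOne I' D) :=
      (ContinuousLinearMap.apply ℝ V ((v, 0) : E × E')).hasFDerivAt.comp _
        (hd.hasFDerivAt.comp (f := fun y : E' => ((chartOne I G, y) : E × E')) _ hi)
    exact DFunLike.congr_fun (h1.fderiv_eq.trans h2.fderiv) w
  rw [hL, hR]
  exact (hΦs.isSymmSndFDerivAt (by
    simp only [minSmoothness_of_isRCLikeNormedField]
    exact WithTop.coe_le_coe.mpr le_top)) _ _

end DerivAtOne

/-! ### The Lie bracket as a commutator of left-invariant differentiations. -/

section BracketAtOne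

open Filter Topology VectorField

variable {E H : Type*} [NormedAddCommGroup E] [NormedSpace ℝ E] [TopologicalSpace H]
  {I : ModelWithCorners ℝ E H} {G : Type*} [TopologicalSpace G]
  [ChartedSpace H G] [Group G] [LieGroup I ∞ G]
  {V : Type*} [NormedAddCommGroup V] [NormedSpace ℝ V]

/-- The Lie algebra laws for `GroupLieAlgebra` and the differentiability of invariant fields are
stated at regularity `minSmoothness ℝ 3`, which over ℝ is 3. -/
lemma LieGroup.minSmoothness_three : LieGroup I (minSmoothness ℝ 3) G := by
  rw [minSmoothness_of_isRCLikeNormedField]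
  exact LieGroup.of_le (n := ∞) (WithTop.coe_le_coe.mpr le_top)

/-- The bracket of the Lie algebra of `G`, on the model space. -/
def lieModel (I : ModelWithCorners ℝ E H) (G : Type*) [TopologicalSpace G]
    [ChartedSpace H G] [Group G] (v w : E) : E :=
  @Bracket.bracket (GroupLieAlgebra I G) (GroupLieAlgebra I G) _ v w

/-- The coordinate expression of a left-invariant vector field. -/
def chartField (I : ModelWithCorners ℝ E H) (G : Type*) [TopologicalSpace G]
    [ChartedSpace H G] [Group G] (v z : E) : E :=
  (mfderivWithin 𝓘(ℝ, E) I (extChartAt I (1 : G)).symm (Set.range I) z).inverse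
    (mulInvariantVectorField (I := I) v ((extChartAt I (1 : G)).symm z))

/-- The bracket of invariant fields is the bracket in the chart carried back by the differential of
the chart, and that differential is the identity at the centre of the chart. -/
lemma lie_eq_lieBracket_chartField [I.Boundaryless] (v w : E) :
    lieModel I G v w
      = lieBracket ℝ (chartField I G v) (chartField I G w)
        (chartOne I G) := by
  have h : ∀ X : E, (mfderiv I 𝓘(ℝ, E) (extChartAt I (1 : G)) 1).inverse X = X := by
    intro X
    rw [mfderiv_extChartAt_self]
    exact DFunLike.congr_fun (ContinuousLinearMap.inverse_id (R := ℝ) (M := TangentSpace I (1 : G))) X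
  refine (h _).trans ?_
  change lieBracketWithin ℝ (chartField I G v) (chartField I G w)
    (_ ∩ Set.range I) _ = _
  rw [Set.preimage_univ, Set.univ_inter, I.range_eq_univ, lieBracketWithin_univ]
  rfl

lemma differentiableAt_chartField [I.Boundaryless] [CompleteSpace E] (v : E) :
    DifferentiableAt ℝ (chartField I G v) (chartOne I G) := by
  have : LieGroup I (minSmoothness ℝ 3) G := LieGroup.minSmoothness_three
  have h := (mdifferentiableAt_mulInvariantVectorField (I := I) (G := G) v
    (g := 1)).mdifferentiableWithinAt (s := Set.univ)
  have h2 : DifferentiableWithinAt ℝ (chartField I G v)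
      ((extChartAt I (1 : G)).symm ⁻¹' Set.univ ∩ Set.range I) (chartOne I G) :=
    h.differentiableWithinAt_mpullbackWithin_vectorField
  rwa [Set.preimage_univ, Set.univ_inter, I.range_eq_univ, differentiableWithinAt_univ] at h2

omit [LieGroup I ∞ G] in
lemma mfderiv_one_of_eq_id {f : G → G} (hf : f = id) :
    (mfderiv I I f 1 : E →L[ℝ] E) = ContinuousLinearMap.id ℝ E := by
  subst hf
  exact mfderiv_id

lemma chartField_chartOne (v : E) :
    chartField I G v (chartOne I G) = v := by
  have h1 : mulInvariantVectorField (I := I) v (1 : G) = v :=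
    DFunLike.congr_fun (mfderiv_one_of_eq_id (I := I) (funext fun x : G => one_mul x)) v
  have h2 : mulInvariantVectorField (I := I) v ((extChartAt I (1 : G)).symm (chartOne I G))
      = (v : E) := by
    have := chartInv_chartOne (G := G) I
    rw [chartInv] at this
    rw [this]
    exact h1
  unfold chartField
  have h3 := mfderivWithin_range_extChartAt_symm (I := I) (x := (1 : G))
  have h4 : ∀ X : E, (mfderivWithin 𝓘(ℝ, E) I (extChartAt I (1 : G)).symm (Set.range I)
      (chartOne I G)).inverse X = X := by
    intro X
    rw [chartOne, h3]
    exact DFunLike.congr_fun (ContinuousLinearMap.inverse_id (R := ℝ) (M := TangentSpace I (1 : G))) X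
  exact (h4 _).trans h2

/-- Chain rule: the differential of the inverse chart sends `chartField` to the left-invariant
field. It is needed on a neighbourhood because both sides get differentiated once more. -/
lemma fderiv_chartField [I.Boundaryless] {f : G → V} (hf : ContMDiffAt I 𝓘(ℝ, V) ∞ f 1)
    (v : E) :
    ∀ᶠ z in 𝓝 (chartOne I G), dOne I (fun k => f (chartInv I G z * k)) v
      = fderiv ℝ (fun z => f (chartInv I G z)) z (chartField I G v z) := by
  have hf1 : ∀ᶠ g in 𝓝 (1 : G), ContMDiffAt I 𝓘(ℝ, V) 1 f g :=
    (contMDiffAt_iff_contMDiffAt_nhds (by simp)).mp (hf.of_le (by simp))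
  have ht := (continuousAt_chartInv (G := G) I).tendsto
  rw [chartInv_chartOne] at ht
  filter_upwards [ht.eventually hf1, chartOne_target_mem_nhds I] with z hz1 hz2
  set g := chartInv I G z with hg
  have hfg : MDifferentiableAt I 𝓘(ℝ, V) f g := hz1.mdifferentiableAt (by simp)
  have hφ : MDifferentiableAt 𝓘(ℝ, E) I (chartInv I G) z :=
    (contMDiffAt_chartInv I hz2).mdifferentiableAt (by simp)
  have hmul : MDifferentiableAt I I (fun k : G => g * k) 1 :=
    (contMDiff_mul_left (I := I) (n := ∞)).contMDiffAt.mdifferentiableAt (by simp)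
  have hfg' : MDifferentiableAt I 𝓘(ℝ, V) f (g * 1) := by rwa [mul_one]
  have e1 : ∀ u : E, fderiv ℝ (fun z => f (chartInv I G z)) z u
      = mfderiv I 𝓘(ℝ, V) f g (mfderiv 𝓘(ℝ, E) I (chartInv I G) z u) := by
    intro u
    have a0 : (mfderiv 𝓘(ℝ, E) 𝓘(ℝ, V) (fun z => f (chartInv I G z)) z : E →L[ℝ] V)
      = fderiv ℝ (fun z => f (chartInv I G z)) z := mfderiv_eq_fderiv
    exact (DFunLike.congr_fun a0 u).symm.trans (DFunLike.congr_fun (mfderiv_comp z hfg hφ) u)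
  have e2 : dOne I (fun k => f (g * k)) v
      = mfderiv I 𝓘(ℝ, V) f (g * 1) (mfderiv I I (fun k : G => g * k) 1 v) :=
    (DFunLike.congr_fun (mfderiv_one_eq_dOne (hfg'.comp (1 : G) hmul)).symm v).trans
      (DFunLike.congr_fun (mfderiv_comp (1 : G) hfg' hmul) v)
  have e3 : (mfderiv 𝓘(ℝ, E) I (chartInv I G) z).IsInvertible := by
    have := isInvertible_mfderivWithin_extChartAt_symm (I := I) hz2
    rw [I.range_eq_univ, mfderivWithin_univ] at this
    exact this
  have e4 : (mfderiv 𝓘(ℝ, E) I (chartInv I G) z : E →L[ℝ] E)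
        (chartField (E := E) I G v z)
      = mulInvariantVectorField (I := I) v g := by
    unfold chartField
    rw [I.range_eq_univ, mfderivWithin_univ]
    exact e3.self_apply_inverse _
  have e5 : mfderiv I 𝓘(ℝ, V) f (g * 1) = mfderiv I 𝓘(ℝ, V) f g := by
    rw [mul_one]
  refine e2.trans ?_
  refine Eq.trans ?_ (e1 _).symm
  refine (DFunLike.congr_fun e5 (mulInvariantVectorField v g)).trans ?_
  exact congrArg (mfderiv I 𝓘(ℝ, V) f g) e4.symm

/-- The bracket is the commutator of left-invariant differentiations. -/
lemma dOne_lie [I.Boundaryless] [CompleteSpace E] {f : G → V} (hf : ContMDiffAt I 𝓘(ℝ, V) ∞ f 1)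
    (v w : E) :
    dOne I f (lieModel I G v w) = dOne I (fun h => dOne I (fun k => f (h * k)) w) v
      - dOne I (fun h => dOne I (fun k => f (h * k)) v) w := by
  set fh : E → V := fun z => f (chartInv I G z) with hfh
  have hs : ContDiffAt ℝ ∞ fh (chartOne I G) := contDiffAt_comp_chartInv hf
  have hd : DifferentiableAt ℝ (fderiv ℝ fh) (chartOne I G) :=
    (hs.fderiv_right (m := ∞) (by simp)).differentiableAt (by simp)
  -- Differentiating df(X_b) along a gives d²f(a, b) + df(DX_b · a). The symmetric first term
  -- cancels in the commutator, and the second yields the bracket of the two fields.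
  have key : ∀ a b : E,
      dOne I (fun h => dOne I (fun k => f (h * k)) b) a
      = fderiv ℝ (fderiv ℝ fh) (chartOne I G) a b
        + fderiv ℝ fh (chartOne I G)
          (fderiv ℝ (chartField I G b) (chartOne I G) a) := by
    intro a b
    have h1 := Filter.EventuallyEq.fderiv_eq (𝕜 := ℝ) (fderiv_chartField hf b)
    have h2 := hd.hasFDerivAt.clm_apply (differentiableAt_chartField (I := I) b).hasFDerivAt
    refine (DFunLike.congr_fun (h1.trans h2.fderiv) a).trans ?_
    have h3 := chartField_chartOne (I := I) (G := G) b
    simp only [add_apply, ContinuousLinearMap.comp_apply,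
      ContinuousLinearMap.flip_apply]
    rw [add_comm, h3]
  rw [key v w, key w v, lie_eq_lieBracket_chartField, lieBracket_eq]
  have hsym : fderiv ℝ (fderiv ℝ fh) (chartOne I G) v w
      = fderiv ℝ (fderiv ℝ fh) (chartOne I G) w v :=
    (hs.isSymmSndFDerivAt (by
      simp only [minSmoothness_of_isRCLikeNormedField]
      exact WithTop.coe_le_coe.mpr le_top)) _ _
  rw [hsym]
  have h3 := chartField_chartOne (I := I) (G := G) v
  have h4 := chartField_chartOne (I := I) (G := G) w
  simp only [dOne, h3, h4, map_sub]
  abel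

end BracketAtOne

/-! ### The adjoint action, its smoothness and its derivative. -/

section AdjointAtOne

open Filter Topology

variable {E H : Type*} [NormedAddCommGroup E] [NormedSpace ℝ E] [TopologicalSpace H]
  {I : ModelWithCorners ℝ E H} {G : Type*} [TopologicalSpace G]
  [ChartedSpace H G] [Group G] [LieGroup I ∞ G]
  {E' H' : Type*} [NormedAddCommGroup E'] [NormedSpace ℝ E'] [TopologicalSpace H']
  {I' : ModelWithCorners ℝ E' H'} {D : Type*} [TopologicalSpace D]
  [ChartedSpace H' D] [Group D] [LieGroup I' ∞ D]
  {V : Type*} [NormedAddCommGroup V] [NormedSpace ℝ V]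

/-- The adjoint action, on the model space. -/
def adModel (I : ModelWithCorners ℝ E H) {G : Type*} [TopologicalSpace G]
    [ChartedSpace H G] [Group G] (g : G) : E →L[ℝ] E :=
  mfderiv I I (fun h : G => g * h * g⁻¹) 1

/-- The differential at the identity, on the model spaces. -/
def mapModel (I : ModelWithCorners ℝ E H) (I' : ModelWithCorners ℝ E' H') {G D : Type*}
    [TopologicalSpace G] [ChartedSpace H G] [Group G] [TopologicalSpace D] [ChartedSpace H' D]
    (ψ : G → D) : E →L[ℝ] E' :=
  mfderiv I I' ψ 1

lemma contMDiff_conj (g : G) : ContMDiff I I ∞ (fun h : G => g * h * g⁻¹) :=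
  (contMDiff_const.mul contMDiff_id).mul contMDiff_const

omit [LieGroup I ∞ G] [LieGroup I' ∞ D] in
lemma mapModel_comp {E₁ H₁ : Type*} [NormedAddCommGroup E₁] [NormedSpace ℝ E₁]
    [TopologicalSpace H₁] {J : ModelWithCorners ℝ E₁ H₁} {M : Type*} [TopologicalSpace M]
    [ChartedSpace H₁ M] {χ : D → M} {ψ : G → D} (h1 : ψ 1 = 1)
    (hχ : ContMDiffAt I' J ∞ χ 1) (hψ : ContMDiffAt I I' ∞ ψ 1) :
    mapModel I J (fun g => χ (ψ g)) = (mapModel I' J χ).comp (mapModel I I' ψ) := by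
  have hχ' : MDifferentiableAt I' J χ (ψ 1) := by
    rw [h1]; exact hχ.mdifferentiableAt (by simp)
  have hψ' : MDifferentiableAt I I' ψ 1 := hψ.mdifferentiableAt (by simp)
  have h2 : (mfderiv I' J χ (ψ 1) : E' →L[ℝ] E₁) = mapModel I' J χ := by rw [h1]; rfl
  have h3 : mapModel I J (fun g => χ (ψ g))
    = (show E' →L[ℝ] E₁ from mfderiv I' J χ (ψ 1)).comp (mapModel I I' ψ) :=
    mfderiv_comp (1 : G) hχ' hψ'
  rw [h3]
  exact congrArg (fun L : E' →L[ℝ] E₁ => L.comp (mapModel I I' ψ)) h2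

omit [LieGroup I ∞ G] in
lemma mapModel_id : mapModel I I (fun g : G => g) = ContinuousLinearMap.id ℝ E :=
  mfderiv_one_of_eq_id rfl

omit [LieGroup I ∞ G] in
lemma adModel_one : adModel I (1 : G) = ContinuousLinearMap.id ℝ E :=
  mfderiv_one_of_eq_id (by ext; simp)

/-- Differentiate ψ(g h g⁻¹) = ψ(g) ψ(h) ψ(g)⁻¹ in h at the identity. -/
lemma mapModel_adModel {ψ : G →* D} (hψ : ContMDiff I I' ∞ ψ) (g : G) :
    (mapModel I I' ψ).comp (adModel I g) = (adModel I' (ψ g)).comp (mapModel I I' ψ) := by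
  have h1 := mapModel_comp (I := I) (I' := I) (J := I') (χ := ψ) (ψ := fun h : G => g * h * g⁻¹)
    (by simp) hψ.contMDiffAt (contMDiff_conj g).contMDiffAt
  have h2 := mapModel_comp (I := I) (I' := I') (J := I') (χ := fun h : D => ψ g * h * (ψ g)⁻¹)
    (ψ := ψ) (by simp) (contMDiff_conj _).contMDiffAt hψ.contMDiffAt
  refine h1.symm.trans (Eq.trans ?_ h2)
  congr 1
  ext h
  simp

lemma adModel_mul (g h : G) : adModel I (g * h) = (adModel I g).comp (adModel I h) := by
  have h1 := mapModel_comp (I := I) (I' := I) (J := I) (χ := fun k : G => g * k * g⁻¹)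
    (ψ := fun k : G => h * k * h⁻¹) (by simp) (contMDiff_conj _).contMDiffAt
    (contMDiff_conj _).contMDiffAt
  refine Eq.trans ?_ h1
  change mapModel I I _ = _
  congr 1
  ext k
  group

lemma adModel_inv_apply (g : G) (v : E) : adModel I g⁻¹ (adModel I g v) = v := by
  have h := adModel_mul (I := I) g⁻¹ g
  rw [inv_mul_cancel, adModel_one] at h
  exact (DFunLike.congr_fun h v).symm

lemma adModel_apply_inv (g : G) (v : E) : adModel I g (adModel I g⁻¹ v) = v := by
  have h := adModel_inv_apply (I := I) g⁻¹ v
  rwa [inv_inv] at h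

lemma contMDiffAt_comp_mul_right {f : G → V} {s : G} (hf : ContMDiffAt I 𝓘(ℝ, V) ∞ f s) :
    ContMDiffAt I 𝓘(ℝ, V) ∞ (fun k => f (k * s)) 1 := by
  have h : ContMDiffAt I 𝓘(ℝ, V) ∞ f (1 * s) := by rwa [one_mul]
  exact h.comp (1 : G) (contMDiff_mul_right (I := I) (a := s)).contMDiffAt

variable [I.Boundaryless] [I'.Boundaryless]

/-- Differentiating along left translates, in terms of right translates. -/
lemma dOne_mul_left {f : G → V} {s : G} (hf : ContMDiffAt I 𝓘(ℝ, V) ∞ f s) (w : E) :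
    dOne I (fun k => f (s * k)) w = dOne I (fun k => f (k * s)) (adModel I s w) := by
  have h := dOne_comp (I := I) (I' := I) (f := fun k => f (k * s))
    (ψ := fun k : G => s * k * s⁻¹) (by simp) (contMDiffAt_comp_mul_right hf)
    (contMDiff_conj s).contMDiffAt w
  refine Eq.trans ?_ h
  congr 2
  ext k
  simp [mul_assoc]

omit [LieGroup I ∞ G] in
lemma dOne_extChartAt [IsManifold I ∞ G] :
    dOne I (extChartAt I (1 : G)) = ContinuousLinearMap.id ℝ E := by
  rw [← mfderiv_one_eq_dOne (mdifferentiableAt_extChartAt (mem_chart_source H (1 : G)))]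
  exact mfderiv_extChartAt_self

/-- The chart has identity differential at 1, so composing with it changes nothing, and Ad becomes a
vector-valued derivative depending on a parameter, to which `contMDiffAt_dOne` applies. -/
lemma adModel_eq_dOne (g : G) :
    adModel I g = dOne I (fun k : G => extChartAt I (1 : G) (g * k * g⁻¹)) := by
  ext w
  have h := dOne_comp (I := I) (I' := I) (f := extChartAt I (1 : G))
    (ψ := fun k : G => g * k * g⁻¹) (by simp) contMDiffAt_extChartAt
    (contMDiff_conj g).contMDiffAt w
  rw [h, dOne_extChartAt]
  rfl

lemma contMDiff_adModel : ContMDiff I 𝓘(ℝ, E →L[ℝ] E) ∞ (adModel I : G → E →L[ℝ] E) := by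
  intro g
  have h : (adModel I : G → E →L[ℝ] E)
      = fun g => dOne I (fun k : G => extChartAt I (1 : G) (g * k * g⁻¹)) :=
    funext adModel_eq_dOne
  rw [h]
  apply contMDiffAt_dOne
  have h1 : ContMDiffAt I 𝓘(ℝ, E) ∞ (extChartAt I (1 : G)) (g * 1 * g⁻¹) := by
    rw [mul_one, mul_inv_cancel]; exact contMDiffAt_extChartAt
  have h2 : ContMDiff (I.prod I) I ∞ (fun p : G × G => p.1 * p.2 * p.1⁻¹) :=
    (contMDiff_fst.mul contMDiff_snd).mul contMDiff_fst.inv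
  exact ContMDiffAt.comp (g, (1 : G)) h1 h2.contMDiffAt

lemma contMDiffAt_dOne_mul_right {f : G → V} {s : G} (hf : ContMDiffAt I 𝓘(ℝ, V) ∞ f s) :
    ContMDiffAt I 𝓘(ℝ, E →L[ℝ] V) ∞ (fun s => dOne I (fun k => f (k * s))) s := by
  apply contMDiffAt_dOne
  have h1 : ContMDiffAt I 𝓘(ℝ, V) ∞ f (1 * s) := by rwa [one_mul]
  have h2 : ContMDiff (I.prod I) I ∞ (fun p : G × G => p.2 * p.1) :=
    contMDiff_snd.mul contMDiff_fst
  exact ContMDiffAt.comp (s, (1 : G)) h1 h2.contMDiffAt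

lemma contMDiffAt_dOne_mul_left {f : G → V} {s : G} (hf : ContMDiffAt I 𝓘(ℝ, V) ∞ f s) :
    ContMDiffAt I 𝓘(ℝ, E →L[ℝ] V) ∞ (fun s => dOne I (fun k => f (s * k))) s := by
  apply contMDiffAt_dOne
  have h1 : ContMDiffAt I 𝓘(ℝ, V) ∞ f (s * 1) := by rwa [mul_one]
  exact ContMDiffAt.comp (s, (1 : G)) h1 (contMDiff_mul I ∞).contMDiffAt

/-- Interchanging the two derivatives and renaming the variables turns f(k h) into f(h k); this is
how right-invariant differentiations are compared with the commutator formula for left-invariant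
ones. -/
lemma dOne_dOne_mul_comm {f : G → V} (hf : ContMDiffAt I 𝓘(ℝ, V) ∞ f 1) (v w : E) :
    dOne I (fun h => dOne I (fun k => f (k * h)) w) v
      = dOne I (fun h => dOne I (fun k => f (h * k)) v) w := by
  have h1 : ContMDiffAt I 𝓘(ℝ, V) ∞ f (1 * 1) := by rwa [one_mul]
  have h2 : ContMDiff (I.prod I) I ∞ (fun p : G × G => p.2 * p.1) :=
    contMDiff_snd.mul contMDiff_fst
  exact dOne_dOne_comm (F := fun h k : G => f (k * h))
    (ContMDiffAt.comp ((1 : G), (1 : G)) h1 h2.contMDiffAt) v w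

/-- The commutator of right-invariant differentiations. -/
lemma dOne_dOne_sub [CompleteSpace E] {f : G → V} {s : G} (hf : ContMDiffAt I 𝓘(ℝ, V) ∞ f s)
    (x y : E) :
    dOne I (fun h => dOne I (fun k => f (k * (h * s))) y) x
      - dOne I (fun h => dOne I (fun k => f (k * (h * s))) x) y
      = - dOne I (fun h => f (h * s)) (lieModel I G x y) := by
  have hF := contMDiffAt_comp_mul_right hf
  simp only [← mul_assoc]
  rw [dOne_lie hF, dOne_dOne_mul_comm hF, dOne_dOne_mul_comm hF]
  abel

/-- The derivative of the adjoint action is the bracket. -/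
lemma dOne_adModel [CompleteSpace E] (v w : E) :
    dOne I (fun h : G => adModel I h w) v = lieModel I G v w := by
  set f : G → E := fun g => extChartAt I (1 : G) g with hf
  have hf1 : ContMDiffAt I 𝓘(ℝ, E) ∞ f 1 := contMDiffAt_extChartAt
  have hev : ∀ᶠ h in 𝓝 (1 : G), dOne I (fun k => f (h * k)) w
      = dOne I (fun k => f (k * h)) (adModel I h w) := by
    filter_upwards [chart_source_mem_nhds H (1 : G)] with h hh
    exact dOne_mul_left (contMDiffAt_extChartAt' hh) w
  have hA : ContMDiffAt I 𝓘(ℝ, E) ∞ (fun h : G => adModel I h w) 1 :=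
    contMDiff_adModel.contMDiffAt.clm_apply contMDiffAt_const
  have hL := contMDiffAt_dOne_mul_right hf1
  have h1 := (hasFDerivAt_comp_chartInv hL).clm_apply (hasFDerivAt_comp_chartInv hA)
  have h2 : dOne I (fun h => dOne I (fun k => f (k * h)) (adModel I h w)) v
      = dOne I (fun k => f (k * 1)) (dOne I (fun h : G => adModel I h w) v)
        + dOne I (fun h => dOne I (fun k => f (k * h))) v (adModel I (1 : G) w) := by
    refine (DFunLike.congr_fun h1.fderiv v).trans ?_
    simp [chartInv_chartOne]
  have h3 : dOne I (fun h => dOne I (fun k => f (k * h))) v w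
      = dOne I (fun h => dOne I (fun k => f (k * h)) w) v := by
    have := ((hasFDerivAt_comp_chartInv hL).clm_apply (hasFDerivAt_const w _)).fderiv
    refine Eq.trans ?_ (DFunLike.congr_fun this v).symm
    simp
  have h4 : dOne I f = ContinuousLinearMap.id ℝ E := dOne_extChartAt
  have h5 := dOne_lie hf1 v w
  rw [dOne_congr hev, h2, adModel_one, ← dOne_dOne_mul_comm hf1 v w] at h5
  simp only [mul_one, h4, ContinuousLinearMap.id_apply, h3] at h5
  rw [h5, add_sub_cancel_right]

/-- The differential of a morphism of Lie groups is a morphism of Lie algebras. -/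
lemma mapModel_lieModel [CompleteSpace E] [CompleteSpace E'] {ψ : G →* D}
    (hψ : ContMDiff I I' ∞ ψ) (v w : E) :
    mapModel I I' ψ (lieModel I G v w)
      = lieModel I' D (mapModel I I' ψ v) (mapModel I I' ψ w) := by
  have hA : ContMDiffAt I 𝓘(ℝ, E) ∞ (fun h : G => adModel I h w) 1 :=
    contMDiff_adModel.contMDiffAt.clm_apply contMDiffAt_const
  have hA' : ContMDiffAt I' 𝓘(ℝ, E') ∞ (fun h : D => adModel I' h (mapModel I I' ψ w)) 1 :=
    contMDiff_adModel.contMDiffAt.clm_apply contMDiffAt_const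
  rw [← dOne_adModel, ← dOne_adModel]
  -- Both brackets are derivatives of Ad, so the claim is the derivative in g of ψ' ∘ Ad_g =
  -- Ad_{ψ(g)} ∘ ψ'.
  have h1 := dOne_comp (map_one ψ) hA' hψ.contMDiffAt v
  refine Eq.trans ?_ h1
  have h2 := ((mapModel I I' ψ).hasFDerivAt.comp _ (hasFDerivAt_comp_chartInv hA)).fderiv
  refine (DFunLike.congr_fun h2 v).symm.trans ?_
  have h3 : (fun g => adModel I' (ψ g) (mapModel I I' ψ w))
      = fun g => mapModel I I' ψ (adModel I g w) :=
    funext fun g => (DFunLike.congr_fun (mapModel_adModel hψ g) w).symm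
  rw [h3]
  rfl

lemma adModel_lieModel [CompleteSpace E] (g : G) (v w : E) :
    adModel I g (lieModel I G v w) = lieModel I G (adModel I g v) (adModel I g w) :=
  mapModel_lieModel (ψ := (MulAut.conj g).toMonoidHom) (contMDiff_conj g) v w

end AdjointAtOne

/-! ### The trilinear identities for an orthogonal automorphism. -/

section TwistedAlgebra

variable {E : Type*} [AddCommGroup E] [Module ℝ E]

/-- A Lie bracket with an invariant symmetric form, and an orthogonal automorphism `A` with
inverse `A'`. -/
structure IsOrthogonalTwist (K : LinearMap.BilinForm ℝ E) (br : E →ₗ[ℝ] E →ₗ[ℝ] E)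
    (A A' : E →ₗ[ℝ] E) : Prop where
  symm : ∀ x y, K x y = K y x
  skew : ∀ x y, br x y = - br y x
  invariant : ∀ x y z, K (br x y) z = K x (br y z)
  orthogonal : ∀ x y, K (A x) (A y) = K x y
  map_br : ∀ x y, A (br x y) = br (A x) (A y)
  apply_inv : ∀ x, A (A' x) = x

/-- The derivative along `v` of `½ (K (A b) a - K (A a) b)`, if `a`, `b` have derivatives `p`, `q`
and `A` has derivative `ad v ∘ A`. -/
def twistDeriv (K : LinearMap.BilinForm ℝ E) (br : E →ₗ[ℝ] E →ₗ[ℝ] E) (A : E →ₗ[ℝ] E)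
    (a b : E) (p q : E → E) (v : E) : ℝ :=
  (1 / 2 : ℝ) * ((K (br v (A b)) a + K (A (q v)) a + K (A b) (p v))
    - (K (br v (A a)) b + K (A (p v)) b + K (A a) (q v)))

namespace IsOrthogonalTwist

variable {K : LinearMap.BilinForm ℝ E} {br : E →ₗ[ℝ] E →ₗ[ℝ] E} {A A' : E →ₗ[ℝ] E}

lemma adjoint (h : IsOrthogonalTwist K br A A') (x y : E) : K (A x) y = K x (A' y) := by
  conv_lhs => rw [← h.apply_inv y]
  exact h.orthogonal _ _

lemma cyclic (h : IsOrthogonalTwist K br A A') (x y z : E) :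
    K x (br y z) = K y (br z x) := by
  rw [← h.invariant y z x, h.symm]

lemma swap (h : IsOrthogonalTwist K br A A') (x y z : E) :
    K x (br y z) = - K x (br z y) := by
  rw [h.skew, map_neg]

lemma triple (h : IsOrthogonalTwist K br A A') (x y z : E) :
    K (A x) (br (A y) (A z)) = K x (br y z) := by
  rw [← h.map_br, h.orthogonal]

/-- Separates the Hessian terms, paired with ½(A⁻¹ − A) a and ½(A⁻¹ − A) b, from the terms produced
by differentiating A. In this form the Hessian terms of different brackets pair up
antisymmetrically. -/
lemma twistDeriv_eq (h : IsOrthogonalTwist K br A A') (a b : E) (p q : E → E) (v : E) :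
    twistDeriv K br A a b p q v
      = K ((1 / 2 : ℝ) • (A' a - A a)) (q v) - K ((1 / 2 : ℝ) • (A' b - A b)) (p v)
        + (1 / 2 : ℝ) * (K a (br v (A b)) - K b (br v (A a))) := by
  unfold twistDeriv
  simp only [map_sub, map_smul, LinearMap.sub_apply, LinearMap.smul_apply, smul_eq_mul]
  rw [h.adjoint (q v) a, h.adjoint (p v) b, h.symm (q v), h.symm (p v),
    h.symm (br v (A b)), h.symm (br v (A a))]
  ring

/-- The algebraic identity behind `½ [P, P] = φ`. -/
lemma schouten_identity (h : IsOrthogonalTwist K br A A') {a b c : E} {p q r : E → E}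
    (hp : ∀ x y, K y (p x) - K x (p y) = - K (br x y) a)
    (hq : ∀ x y, K y (q x) - K x (q y) = - K (br x y) b)
    (hr : ∀ x y, K y (r x) - K x (r y) = - K (br x y) c) :
    -(twistDeriv K br A a b p q ((1 / 2 : ℝ) • (A' c - A c))
      + twistDeriv K br A b c q r ((1 / 2 : ℝ) • (A' a - A a))
      + twistDeriv K br A c a r p ((1 / 2 : ℝ) • (A' b - A b)))
      = (1 / 4 : ℝ) * K (c - A' c) (br (a - A' a) (b - A' b)) := by
  rw [h.twistDeriv_eq, h.twistDeriv_eq, h.twistDeriv_eq]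
  -- Each Hessian occurs twice in the cyclic sum, with its two arguments exchanged and opposite
  -- signs, so only its antisymmetric part, a bracket, survives.
  have e1 := hp ((1 / 2 : ℝ) • (A' c - A c)) ((1 / 2 : ℝ) • (A' b - A b))
  have e2 := hq ((1 / 2 : ℝ) • (A' a - A a)) ((1 / 2 : ℝ) • (A' c - A c))
  have e3 := hr ((1 / 2 : ℝ) • (A' b - A b)) ((1 / 2 : ℝ) • (A' a - A a))
  rw [h.symm (br _ _)] at e1 e2 e3
  set u := (1 / 2 : ℝ) • (A' a - A a) with hu
  set v := (1 / 2 : ℝ) • (A' b - A b) with hv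
  set w := (1 / 2 : ℝ) • (A' c - A c) with hw
  have main : (K a (br w v) + K b (br u w) + K c (br v u))
      + (1 / 2 : ℝ) * (K a (br w (A b)) - K b (br w (A a)))
      + (1 / 2 : ℝ) * (K b (br u (A c)) - K c (br u (A b)))
      + (1 / 2 : ℝ) * (K c (br v (A a)) - K a (br v (A c)))
      = - ((1 / 4 : ℝ) * K (c - A' c) (br (a - A' a) (b - A' b))) := by
    clear e1 e2 e3
    rw [hu, hv, hw]
    simp only [map_sub, map_smul, LinearMap.sub_apply, LinearMap.smul_apply, smul_eq_mul]
    -- Orthogonality applied in all three slots: `i1` makes two of the eight terms on the right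
    -- cancel, and `i2`, `i3`, `i4` trade the terms with a single A' for terms with two A's. The
    -- facts `f1`, `f2`, `f3` and `cyclic` bring the remaining terms to common orderings.
    have i1 := h.triple (A' c) (A' a) (A' b)
    have i2 := h.triple (A' c) a b
    have i3 := h.triple c (A' a) b
    have i4 := h.triple c a (A' b)
    simp only [h.apply_inv] at i1 i2 i3 i4
    have f1 : ∀ y z, K a (br y z) = - K y (br a z) := fun y z => by rw [h.cyclic, h.swap]
    have f2 : ∀ y z, K b (br y z) = - K z (br y b) := fun y z => by
      rw [h.swap, h.cyclic, h.swap]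
    have f3 : ∀ y z, K c (br y z) = - K c (br z y) := fun y z => h.swap _ _ _
    linarith [f1 (A' c) (A' b), f1 (A' c) (A b), f1 (A c) (A' b), f1 (A c) (A b),
      f2 (A' a) (A' c), f2 (A' a) (A c), f2 (A a) (A' c), f2 (A a) (A c),
      f3 (A' b) (A' a), f3 (A' b) (A a), f3 (A b) (A' a), f3 (A b) (A a),
      h.cyclic b (A' c) (A a), h.cyclic b (A c) (A a), (h.cyclic (A c) a (A' b)),
      (h.cyclic (A c) a (A b))]
  linarith

/-- The algebra behind L_{x_S} P = 0. The three groups of terms come from x_S{f, g}, {x_S f, g} and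
{f, x_S g}; the Hessians again combine antisymmetrically, and invariance and orthogonality finish.
-/
lemma lie_identity (h : IsOrthogonalTwist K br A A') {a b x : E} {p q : E → E}
    (hp : ∀ x y, K y (p x) - K x (p y) = - K (br x y) a)
    (hq : ∀ x y, K y (q x) - K x (q y) = - K (br x y) b) :
    twistDeriv K br A a b p q (x - A x)
      + (K (p ((1 / 2 : ℝ) • (A' b - A b))) (x - A x)
        - K a (br ((1 / 2 : ℝ) • (A' b - A b)) (A x)))
      - (K (q ((1 / 2 : ℝ) • (A' a - A a))) (x - A x)
        - K b (br ((1 / 2 : ℝ) • (A' a - A a)) (A x))) = 0 := by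
  rw [h.twistDeriv_eq]
  have e1 := hp ((1 / 2 : ℝ) • (A' b - A b)) (x - A x)
  have e2 := hq ((1 / 2 : ℝ) • (A' a - A a)) (x - A x)
  rw [h.symm (br _ _)] at e1 e2
  rw [h.symm (p _), h.symm (q _)]
  have main : - K a (br ((1 / 2 : ℝ) • (A' b - A b)) (x - A x))
      + K b (br ((1 / 2 : ℝ) • (A' a - A a)) (x - A x))
      + (1 / 2 : ℝ) * (K a (br (x - A x) (A b)) - K b (br (x - A x) (A a)))
      - K a (br ((1 / 2 : ℝ) • (A' b - A b)) (A x))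
      + K b (br ((1 / 2 : ℝ) • (A' a - A a)) (A x)) = 0 := by
    simp only [map_sub, map_smul, LinearMap.sub_apply, LinearMap.smul_apply, smul_eq_mul]
    have i1 := h.triple (A' a) b x
    have i2 := h.triple (A' b) a x
    simp only [h.apply_inv] at i1 i2
    linarith [h.cyclic a (A' b) x, h.cyclic b (A' a) x, h.swap a x (A b), h.swap b x (A a),
      h.swap a (A x) (A b), h.swap b (A x) (A a), h.swap a (A b) x, h.swap b (A a) x,
      h.cyclic (A' a) b x, h.cyclic (A' b) a x, h.cyclic x (A' a) b, h.cyclic x (A' b) a,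
      h.swap b x (A' a), h.swap a x (A' b), h.swap x (A' a) b]
  linarith

end IsOrthogonalTwist
end TwistedAlgebra

/-! ### Gradients, Hessians and brackets in the right trivialisation. -/

section Gradient

open Filter Topology

variable {E H : Type*} [NormedAddCommGroup E] [NormedSpace ℝ E] [TopologicalSpace H]
  {I : ModelWithCorners ℝ E H} {G : Type*} [TopologicalSpace G]
  [ChartedSpace H G] [Group G]
  {E₁ H₁ : Type*} [NormedAddCommGroup E₁] [NormedSpace ℝ E₁] [TopologicalSpace H₁]
  {J : ModelWithCorners ℝ E₁ H₁} {M : Type*} [TopologicalSpace M] [ChartedSpace H₁ M]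

/-- The bridge between covectors on tangent spaces and derivatives on the model space: a tangent
vector given as the velocity of a map from a group is paired with df by the chain rule. -/
lemma covec_mfderiv_one [I.Boundaryless] {χ : G → M} {m : M} {f : M → ℝ} (h1 : χ 1 = m)
    (hf : MDifferentiableAt J 𝓘(ℝ, ℝ) f m) (hχ : MDifferentiableAt I J χ 1) (x : E) :
    covec J f m (mapModel I J χ x) = dOne I (fun g => f (χ g)) x := by
  subst h1
  exact (DFunLike.congr_fun (mfderiv_comp (1 : G) hf hχ) x).symm.trans
    (DFunLike.congr_fun (mfderiv_one_eq_dOne (hf.comp (1 : G) hχ)) x)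

variable [LieGroup I ∞ G] [I.Boundaryless]

lemma covec_rightTriv {f : G → ℝ} {s : G} (hf : MDifferentiableAt I 𝓘(ℝ, ℝ) f s) (x : E) :
    covec I f s (rightTriv I s x) = dOne I (fun k => f (k * s)) x :=
  covec_mfderiv_one (χ := fun k : G => k * s) (one_mul s) hf
    ((contMDiff_mul_right (I := I) (n := ∞)).contMDiffAt.mdifferentiableAt (by simp)) x

lemma covec_leftTriv {f : G → ℝ} {s : G} (hf : MDifferentiableAt I 𝓘(ℝ, ℝ) f s) (x : E) :
    covec I f s (leftTriv I s x) = dOne I (fun k => f (s * k)) x :=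
  covec_mfderiv_one (χ := fun k : G => s * k) (mul_one s) hf
    ((contMDiff_mul_left (I := I) (n := ∞)).contMDiffAt.mdifferentiableAt (by simp)) x

variable [FiniteDimensional ℝ E]

/-- The gradient of a function for the form `K`, in the right trivialisation. -/
def rightGrad (I : ModelWithCorners ℝ E H) {K : LinearMap.BilinForm ℝ E} (hK : K.Nondegenerate)
    (f : G → ℝ) (s : G) : E :=
  (K.toDual hK).symm (dOne I (fun k => f (k * s))).toLinearMap

variable {K : LinearMap.BilinForm ℝ E} (hK : K.Nondegenerate)

omit [LieGroup I ∞ G] [I.Boundaryless] in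
lemma apply_rightGrad (f : G → ℝ) (s : G) (x : E) :
    K (rightGrad I hK f s) x = dOne I (fun k => f (k * s)) x :=
  LinearMap.BilinForm.apply_toDual_symm_apply (hB := hK) _ _

lemma contMDiffAt_rightGrad {f : G → ℝ} {s : G} (hf : ContMDiffAt I 𝓘(ℝ, ℝ) ∞ f s) :
    ContMDiffAt I 𝓘(ℝ, E) ∞ (rightGrad I hK f) s := by
  let L : (E →L[ℝ] ℝ) →L[ℝ] E := LinearMap.toContinuousLinearMap
    ((K.toDual hK).symm.toLinearMap.comp
      (LinearMap.toContinuousLinearMap (𝕜 := ℝ) (E := E) (F' := ℝ)).symm.toLinearMap)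
  exact L.contDiff.contMDiff.contMDiffAt.comp s (contMDiffAt_dOne_mul_right hf)

/-- The derivative of the gradient at `s`. -/
def rightHess (I : ModelWithCorners ℝ E H) {K : LinearMap.BilinForm ℝ E} (hK : K.Nondegenerate)
    (f : G → ℝ) (s : G) : E →L[ℝ] E :=
  dOne I (fun h => rightGrad I hK f (h * s))

/-- The form `K` as a continuous bilinear map. -/
def contForm (K : LinearMap.BilinForm ℝ E) : E →L[ℝ] E →L[ℝ] ℝ :=
  LinearMap.toContinuousLinearMap ((LinearMap.toContinuousLinearMap (𝕜 := ℝ) (E := E)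
    (F' := ℝ)).toLinearMap.comp K)

omit [LieGroup I ∞ G] [I.Boundaryless] [TopologicalSpace H] in
lemma contForm_apply (x y : E) : contForm K x y = K x y := rfl

lemma hasFDerivAt_rightGrad {f : G → ℝ} {s : G} (hf : ContMDiffAt I 𝓘(ℝ, ℝ) ∞ f s) :
    HasFDerivAt (fun z => rightGrad I hK f (chartInv I G z * s)) (rightHess I hK f s)
      (chartOne I G) :=
  hasFDerivAt_comp_chartInv (contMDiffAt_comp_mul_right (contMDiffAt_rightGrad hK hf))

/-- K(y, Hess x) is the iterated derivative of f along the right-invariant fields of y and then x.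
Its antisymmetric part is therefore their commutator, where the minus sign comes from right
invariance. -/
lemma rightHess_sub {f : G → ℝ} {s : G} (hf : ContMDiffAt I 𝓘(ℝ, ℝ) ∞ f s)
    (hs : ∀ x y, K x y = K y x) (x y : E) :
    K y (rightHess I hK f s x) - K x (rightHess I hK f s y)
      = - K (lieModel I G x y) (rightGrad I hK f s) := by
  have key : ∀ x y : E, dOne I (fun h => dOne I (fun k => f (k * (h * s))) y) x
      = K y (rightHess I hK f s x) := by
    intro x y
    have h1 : (fun h => dOne I (fun k => f (k * (h * s))) y)
        = fun h => contForm K y (rightGrad I hK f (h * s)) := by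
      funext h
      rw [contForm_apply, hs, apply_rightGrad]
    have h2 := ((contForm K y).hasFDerivAt.comp _ (hasFDerivAt_rightGrad hK hf)).fderiv
    rw [h1]
    exact DFunLike.congr_fun h2 x
  rw [← key, ← key, hs, apply_rightGrad, dOne_dOne_sub hf]

/-- The operator `Ad_s ∘ S`. -/
def twistedAd (I : ModelWithCorners ℝ E H) (S : E →L[ℝ] E) (s : G) : E →L[ℝ] E :=
  (adModel I s).comp S

omit [FiniteDimensional ℝ E] in
lemma contMDiff_twistedAd (S : E →L[ℝ] E) :
    ContMDiff I 𝓘(ℝ, E →L[ℝ] E) ∞ (twistedAd I S : G → E →L[ℝ] E) :=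
  contMDiff_adModel.clm_comp contMDiff_const

/-- Ad_{hs} = Ad_h ∘ Ad_s, and the derivative of Ad_h at h = 1 is the bracket. -/
lemma dOne_twistedAd (S : E →L[ℝ] E) (s : G) (v y : E) :
    dOne I (fun h => twistedAd I S (h * s)) v y = lieModel I G v (twistedAd I S s y) := by
  have h0 : ContMDiffAt I 𝓘(ℝ, E →L[ℝ] E) ∞ (fun h => twistedAd I S (h * s)) 1 :=
    contMDiffAt_comp_mul_right (contMDiff_twistedAd S).contMDiffAt
  have h1 := ((hasFDerivAt_comp_chartInv h0).clm_apply (hasFDerivAt_const y _)).fderiv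
  have h2 : dOne I (fun h => twistedAd I S (h * s) y) v
      = dOne I (fun h => twistedAd I S (h * s)) v y := by
    refine (DFunLike.congr_fun h1 v).trans ?_
    simp
  rw [← h2, ← dOne_adModel]
  congr 2
  ext h
  rw [twistedAd, adModel_mul]
  rfl

/-- The bracket of functions with `K`-gradients `a`, `b`, given by `½ (K (A b) a - K (A a) b)`. -/
def twistedBracket (I : ModelWithCorners ℝ E H) {K : LinearMap.BilinForm ℝ E}
    (hK : K.Nondegenerate) (S : E →L[ℝ] E) (f g : G → ℝ) (s : G) : ℝ :=
  (1 / 2 : ℝ) * (contForm K (twistedAd I S s (rightGrad I hK g s)) (rightGrad I hK f s)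
    - contForm K (twistedAd I S s (rightGrad I hK f s)) (rightGrad I hK g s))

lemma contMDiffAt_twistedBracket (S : E →L[ℝ] E) {f g : G → ℝ} {s : G}
    (hf : ContMDiffAt I 𝓘(ℝ, ℝ) ∞ f s) (hg : ContMDiffAt I 𝓘(ℝ, ℝ) ∞ g s) :
    ContMDiffAt I 𝓘(ℝ, ℝ) ∞ (twistedBracket I hK S f g) s := by
  have hA := (contMDiff_twistedAd (I := I) S).contMDiffAt (x := s)
  have ha := contMDiffAt_rightGrad hK hf
  have hb := contMDiffAt_rightGrad hK hg
  have hc : ∀ {u v : G → E}, ContMDiffAt I 𝓘(ℝ, E) ∞ u s → ContMDiffAt I 𝓘(ℝ, E) ∞ v s →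
      ContMDiffAt I 𝓘(ℝ, ℝ) ∞ (fun s => contForm K (twistedAd I S s (u s)) (v s)) s :=
    fun hu hv => ((contForm K).contDiff.contMDiff.contMDiffAt.comp s (hA.clm_apply hu)).clm_apply hv
  exact contMDiffAt_const.mul ((hc hb ha).sub (hc ha hb))

/-- Product rule for ½(K(A b, a) − K(A a, b)), with the gradients differentiating to Hessians and A
to ad_v ∘ A. -/
lemma dOne_twistedBracket (S : E →L[ℝ] E) {f g : G → ℝ} {s : G}
    (hf : ContMDiffAt I 𝓘(ℝ, ℝ) ∞ f s) (hg : ContMDiffAt I 𝓘(ℝ, ℝ) ∞ g s)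
    {br : E →ₗ[ℝ] E →ₗ[ℝ] E} (hbr : ∀ x y, br x y = lieModel I G x y) (v : E) :
    dOne I (fun h => twistedBracket I hK S f g (h * s)) v
      = twistDeriv K br (twistedAd I S s).toLinearMap (rightGrad I hK f s) (rightGrad I hK g s)
        (rightHess I hK f s) (rightHess I hK g s) v := by
  have h0 : ContMDiffAt I 𝓘(ℝ, E →L[ℝ] E) ∞ (fun h => twistedAd I S (h * s)) 1 :=
    contMDiffAt_comp_mul_right (contMDiff_twistedAd S).contMDiffAt
  have hA := hasFDerivAt_comp_chartInv h0
  have ha := hasFDerivAt_rightGrad hK hf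
  have hb := hasFDerivAt_rightGrad hK hg
  have h1 := ((contForm K).hasFDerivAt.comp _ (hA.clm_apply hb)).clm_apply ha
  have h2 := ((contForm K).hasFDerivAt.comp _ (hA.clm_apply ha)).clm_apply hb
  have h3 := ((h1.sub h2).const_mul (1 / 2 : ℝ)).fderiv
  refine (DFunLike.congr_fun h3 v).trans ?_
  simp only [Function.comp_apply, chartInv_chartOne, one_mul, smul_apply, sub_apply, add_apply,
    ContinuousLinearMap.comp_apply, ContinuousLinearMap.flip_apply, dOne_twistedAd, map_add,
    contForm_apply, smul_eq_mul, twistDeriv, hbr, ContinuousLinearMap.coe_coe]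
  ring

/-- The derivative of `s ↦ K (∇f s) (x - A_s x)`, where `A_s = Ad_s ∘ S`. -/
lemma dOne_twistedAction (S : E →L[ℝ] E) {f : G → ℝ} {s : G}
    (hf : ContMDiffAt I 𝓘(ℝ, ℝ) ∞ f s) (x v : E) :
    dOne I (fun h => contForm K (rightGrad I hK f (h * s)) (x - twistedAd I S (h * s) x)) v
      = K (rightHess I hK f s v) (x - twistedAd I S s x)
        - K (rightGrad I hK f s) (lieModel I G v (twistedAd I S s x)) := by
  have h0 : ContMDiffAt I 𝓘(ℝ, E →L[ℝ] E) ∞ (fun h => twistedAd I S (h * s)) 1 :=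
    contMDiffAt_comp_mul_right (contMDiff_twistedAd S).contMDiffAt
  have hA := hasFDerivAt_comp_chartInv h0
  have ha := hasFDerivAt_rightGrad hK hf
  have h1 := ((contForm K).hasFDerivAt.comp _ ha).clm_apply
    ((hasFDerivAt_const x _).sub (hA.clm_apply (hasFDerivAt_const x _)))
  refine (DFunLike.congr_fun h1.fderiv v).trans ?_
  simp only [Function.comp_apply, chartInv_chartOne, one_mul, sub_apply, add_apply,
    ContinuousLinearMap.comp_apply, ContinuousLinearMap.flip_apply, dOne_twistedAd, map_add,
    map_sub, contForm_apply, zero_apply, map_zero, Pi.sub_apply]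
  ring

end Gradient

/-! ### Bilinearity of the bracket and ad-invariance of the form. -/

section LieModelAlgebra

variable {E H : Type*} [NormedAddCommGroup E] [NormedSpace ℝ E] [TopologicalSpace H]
  {I : ModelWithCorners ℝ E H} {G : Type*} [TopologicalSpace G]
  [ChartedSpace H G] [Group G] [LieGroup I ∞ G]

section

variable (I G) in
/-- The Lie bracket on the model space, as a bilinear map. -/
def lieBilin [CompleteSpace E] : E →ₗ[ℝ] E →ₗ[ℝ] E :=
  have : LieGroup I (minSmoothness ℝ 3) G := LieGroup.minSmoothness_three
  LinearMap.mk₂ ℝ (lieModel I G)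
    (fun x y z => add_lie (L := GroupLieAlgebra I G) (M := GroupLieAlgebra I G) x y z)
    (fun c x y => smul_lie (L := GroupLieAlgebra I G) (M := GroupLieAlgebra I G) c x y)
    (fun x y z => lie_add (L := GroupLieAlgebra I G) (M := GroupLieAlgebra I G) x y z)
    (fun c x y => lie_smul (L := GroupLieAlgebra I G) (M := GroupLieAlgebra I G) c x y)

variable [CompleteSpace E]

lemma lieBilin_apply (x y : E) : lieBilin I G x y = lieModel I G x y := rfl

lemma lieModel_skew (x y : E) : lieModel I G x y = - lieModel I G y x :=
  have : LieGroup I (minSmoothness ℝ 3) G := LieGroup.minSmoothness_three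
  (lie_skew (L := GroupLieAlgebra I G) x y).symm

end

variable [I.Boundaryless] [FiniteDimensional ℝ E]

/-- Differentiate the constant function g ↦ K(Ad_g x, Ad_g z) at 1 along y. -/
lemma form_lieModel {K : LinearMap.BilinForm ℝ E}
    (hAd : ∀ (g : G) (x y : E), K (adModel I g x) (adModel I g y) = K x y) (x y z : E) :
    K (lieModel I G x y) z = K x (lieModel I G y z) := by
  have hd : ∀ w : E, HasFDerivAt (fun t => adModel I (chartInv I G t) w)
      (dOne I (fun h : G => adModel I h w)) (chartOne I G) := fun w =>
    hasFDerivAt_comp_chartInv (contMDiff_adModel.contMDiffAt.clm_apply contMDiffAt_const)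
  have h1 := ((contForm K).hasFDerivAt.comp _ (hd x)).clm_apply (hd z)
  have h2 : HasFDerivAt (fun _ : E => K x z) (0 : E →L[ℝ] ℝ) (chartOne I G) :=
    hasFDerivAt_const _ _
  have h3 := h1.unique (h2.congr_of_eventuallyEq (Filter.Eventually.of_forall
    fun t => hAd (chartInv I G t) x z))
  have h4 := DFunLike.congr_fun h3 y
  simp only [Function.comp_apply, chartInv_chartOne, add_apply, adModel_one,
    ContinuousLinearMap.comp_apply, ContinuousLinearMap.flip_apply, dOne_adModel,
    contForm_apply, ContinuousLinearMap.id_apply, zero_apply] at h4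
  rw [lieModel_skew x y, map_neg, LinearMap.neg_apply]
  linarith

end LieModelAlgebra

/-! ### The Lie algebra of G × G as `E × E`. -/

section DoubleModel

variable {E H : Type*} [NormedAddCommGroup E] [NormedSpace ℝ E] [TopologicalSpace H]
  {I : ModelWithCorners ℝ E H} {G : Type*} [TopologicalSpace G]
  [ChartedSpace H G] [Group G]

lemma mapModel_fst : mapModel (I.prod I) I (Prod.fst : G × G → G)
    = ContinuousLinearMap.fst ℝ E E := mfderiv_fst

lemma mapModel_snd : mapModel (I.prod I) I (Prod.snd : G × G → G)
    = ContinuousLinearMap.snd ℝ E E := mfderiv_snd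

lemma lieFst_apply (v : E × E) : lieFst I G v = v.1 := DFunLike.congr_fun mapModel_fst v

lemma lieSnd_apply (v : E × E) : lieSnd I G v = v.2 := DFunLike.congr_fun mapModel_snd v

lemma homDeriv_prod_apply {φ ψ : G →* G} (hφ : ContMDiff I I ∞ φ) (hψ : ContMDiff I I ∞ ψ)
    (x : E) : homDeriv I (I.prod I) (φ.prod ψ) x = (mapModel I I φ x, mapModel I I ψ x) :=
  DFunLike.congr_fun (mfderiv_prodMk (hφ.contMDiffAt.mdifferentiableAt (by simp))
    (hψ.contMDiffAt.mdifferentiableAt (by simp))) x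

lemma mapModel_one : mapModel I I (fun _ : G => (1 : G)) = 0 := mfderiv_const

lemma twistedAntidiag_apply (σ : G →* G) (x : E) :
    twistedAntidiag I σ x = (x, - mapModel I I σ x) := by
  have h1 : homDeriv I (I.prod I) (MonoidHom.inl G G) x = (x, (0 : E)) := by
    have := homDeriv_prod_apply (I := I) (φ := MonoidHom.id G) (ψ := (1 : G →* G)) contMDiff_id
      contMDiff_const x
    refine Eq.trans this (Prod.ext ?_ ?_)
    · exact DFunLike.congr_fun mapModel_id x
    · exact DFunLike.congr_fun mapModel_one x
  have h2 : ∀ y : E, homDeriv I (I.prod I) (MonoidHom.inr G G) y = ((0 : E), y) := by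
    intro y
    have := homDeriv_prod_apply (I := I) (φ := (1 : G →* G)) (ψ := MonoidHom.id G) contMDiff_const
      contMDiff_id y
    refine Eq.trans this (Prod.ext ?_ ?_)
    · exact DFunLike.congr_fun mapModel_one y
    · exact DFunLike.congr_fun mapModel_id y
  have h3 : twistedAntidiag I σ x = ((x, (0 : E)) : E × E) - ((0 : E), mapModel I I σ x) :=
    congrArg₂ (fun a b : E × E => a - b) h1 (h2 _)
  exact h3.trans (Prod.ext (sub_zero x) (zero_sub _))

lemma homDeriv_twistedDiag {σ : G →* G} (hσ : ContMDiff I I ∞ σ) (x : E) :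
    homDeriv I (I.prod I) (twistedDiag σ) x = (x, mapModel I I σ x) :=
  (homDeriv_prod_apply contMDiff_id hσ x).trans
    (Prod.ext (DFunLike.congr_fun mapModel_id x) rfl)

variable [LieGroup I ∞ G]

lemma adModel_prod (d : G × G) (v : E × E) :
    adModel (I.prod I) d v = (adModel I d.1 v.1, adModel I d.2 v.2) := by
  have h1 := DFunLike.congr_fun (mapModel_adModel (I := I.prod I) (I' := I)
    (ψ := MonoidHom.fst G G) contMDiff_fst d) v
  have h2 := DFunLike.congr_fun (mapModel_adModel (I := I.prod I) (I' := I)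
    (ψ := MonoidHom.snd G G) contMDiff_snd d) v
  have e1 : mapModel (I.prod I) I (MonoidHom.fst G G) = ContinuousLinearMap.fst ℝ E E :=
    mapModel_fst
  have e2 : mapModel (I.prod I) I (MonoidHom.snd G G) = ContinuousLinearMap.snd ℝ E E :=
    mapModel_snd
  rw [e1] at h1
  rw [e2] at h2
  exact Prod.ext h1 h2

/-- The two projections are group morphisms, so their differentials preserve brackets. -/
lemma lieModel_prod [CompleteSpace E] [I.Boundaryless] (v w : E × E) :
    lieModel (I.prod I) (G × G) v w = (lieModel I G v.1 w.1, lieModel I G v.2 w.2) := by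
  have h1 := mapModel_lieModel (I := I.prod I) (I' := I)
    (ψ := MonoidHom.fst G G) contMDiff_fst v w
  have h2 := mapModel_lieModel (I := I.prod I) (I' := I)
    (ψ := MonoidHom.snd G G) contMDiff_snd v w
  have e1 : mapModel (I.prod I) I (MonoidHom.fst G G) = ContinuousLinearMap.fst ℝ E E :=
    mapModel_fst
  have e2 : mapModel (I.prod I) I (MonoidHom.snd G G) = ContinuousLinearMap.snd ℝ E E :=
    mapModel_snd
  rw [e1] at h1
  rw [e2] at h2
  exact Prod.ext h1 h2

end DoubleModel

/-! ### The r-matrix as a projection. -/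

namespace IsIsotropicSplitting

variable {V W : Type*} [AddCommGroup V] [Module ℝ V] [AddCommGroup W] [Module ℝ W]
  {B : LinearMap.BilinForm ℝ V} {i : W →ₗ[ℝ] V} {𝔥 : Submodule ℝ V}

lemma j_eq [FiniteDimensional ℝ V] (h : IsIsotropicSplitting B i 𝔥) {ξ : Module.Dual ℝ W} {y : 𝔥}
    (hy : ∀ x, B y (i x) = ξ x) : h.j ξ = y :=
  (LinearEquiv.symm_apply_eq _).mpr (LinearMap.ext fun x => (hy x).symm)

/-- By isotropy, pairing u with i(W) only sees the component of u in 𝔥. Under the identification of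
V* with V by B, the r-matrix thus becomes the projection onto 𝔥. -/
lemma rMatrix_form [FiniteDimensional ℝ V] (h : IsIsotropicSplitting B i 𝔥) (u : V) :
    h.rMatrix (B u) = h.projMinus u := by
  refine congrArg Subtype.val (h.j_eq fun x => ?_)
  conv_rhs => rw [← h.projPlus_add_projMinus u]
  change B (h.projMinus u) (i x) = B (i (h.projPlus u) + h.projMinus u) (i x)
  rw [map_add, LinearMap.add_apply, h.isotropic_range, zero_add]

/-- Both summands are isotropic, so ⟨u, u⟩ consists of two equal cross terms, one of which is ⟨u,
p_- u⟩. The symmetric part of r is thus half of the inverse form. -/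
lemma form_projMinus (h : IsIsotropicSplitting B i 𝔥) (u : V) :
    B u (h.projMinus u) = (1 / 2 : ℝ) * B u u := by
  have h1 := h.projPlus_add_projMinus u
  set x := h.projPlus u
  set y := h.projMinus u
  rw [← h1]
  simp only [map_add, LinearMap.add_apply, h.isotropic_range, h.isotropic_compl _ y.2 _ y.2,
    zero_add, add_zero]
  rw [h.symm.eq (i x) (y : V)]
  ring

end IsIsotropicSplitting

/-! ### Derivatives of products, inverses and twisted translations. -/

section ChainRules

variable {E H : Type*} [NormedAddCommGroup E] [NormedSpace ℝ E] [TopologicalSpace H]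
  {I : ModelWithCorners ℝ E H} {G : Type*} [TopologicalSpace G]
  [ChartedSpace H G] [Group G]
  {E₁ H₁ : Type*} [NormedAddCommGroup E₁] [NormedSpace ℝ E₁] [TopologicalSpace H₁]
  {J : ModelWithCorners ℝ E₁ H₁} {M : Type*} [TopologicalSpace M] [ChartedSpace H₁ M]
  {E₂ H₂ : Type*} [NormedAddCommGroup E₂] [NormedSpace ℝ E₂] [TopologicalSpace H₂]
  {J' : ModelWithCorners ℝ E₂ H₂} {N : Type*} [TopologicalSpace N] [ChartedSpace H₂ N]

lemma tangentLin_mapModel {F : M → N} {χ : G → M} {m : M} (h1 : χ 1 = m)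
    (hF : MDifferentiableAt J J' F m) (hχ : MDifferentiableAt I J χ 1) (x : E) :
    tangentLin J J' F m (mapModel I J χ x) = mapModel I J' (fun g => F (χ g)) x := by
  subst h1
  exact (DFunLike.congr_fun (mfderiv_comp (1 : G) hF hχ) x).symm

variable [LieGroup I ∞ G]

lemma leftTriv_eq (g : G) (x : E) : leftTriv I g x = rightTriv I g (adModel I g x) := by
  have h := mapModel_comp (I := I) (I' := I) (J := I) (χ := fun k : G => k * g)
    (ψ := fun k : G => g * k * g⁻¹) (by simp) (contMDiff_mul_right (a := g)).contMDiffAt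
    (contMDiff_conj g).contMDiffAt
  simp only [inv_mul_cancel_right] at h
  exact DFunLike.congr_fun h x

lemma rightTriv_surjective (g : G) : Function.Surjective (rightTriv I g) := by
  intro y
  -- The preimage comes from right translation by g⁻¹, the inverse diffeomorphism.
  refine ⟨tangentLin I I (fun h : G => h * g⁻¹) g y, ?_⟩
  have h1 : ∀ F : G → G, F = id → ∀ y : E, tangentLin I I F g y = y := by
    rintro F rfl y
    exact DFunLike.congr_fun (mfderiv_id (I := I) (x := g)) y
  have h2 := h1 ((fun h : G => h * g) ∘ fun h : G => h * g⁻¹) (by ext; simp) y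
  have hd : ∀ a b : G, MDifferentiableAt I I (fun h : G => h * a) b := fun a b =>
    (contMDiff_mul_right (I := I) (n := ∞)).contMDiffAt.mdifferentiableAt (by simp)
  have h3 := DFunLike.congr_fun (mfderiv_comp g (hd g (g * g⁻¹)) (hd g⁻¹ g)) y
  have h4 : ∀ b : G, b = 1 → ∀ z : E, tangentLin I I (fun h : G => h * g) b z
      = (rightTriv I g z : E) := by
    rintro b rfl z; rfl
  exact (h4 _ (mul_inv_cancel g) _).symm.trans (h3.symm.trans h2)

lemma mapModel_mul_apply (v : E × E) :
    mapModel (I.prod I) I (fun p : G × G => p.1 * p.2) v = v.1 + v.2 := by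
  have hm : ContMDiffAt (I.prod I) I ∞ (fun p : G × G => p.1 * p.2) 1 :=
    (contMDiff_mul I ∞).contMDiffAt
  have h1 : mapModel (I.prod I) I (fun p : G × G => p.1 * p.2) (v.1, 0) = v.1 := by
    have h := mapModel_comp (I := I) (I' := I.prod I) (J := I)
      (χ := fun p : G × G => p.1 * p.2) (ψ := (MonoidHom.id G).prod (1 : G →* G)) rfl hm
      (contMDiff_id.prodMk contMDiff_const).contMDiffAt
    have h2 := (homDeriv_prod_apply (I := I) (φ := MonoidHom.id G) (ψ := (1 : G →* G))
      contMDiff_id contMDiff_const v.1).trans (Prod.ext (DFunLike.congr_fun mapModel_id v.1)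
        (DFunLike.congr_fun mapModel_one v.1) : _ = (v.1, (0 : E)))
    have h3 : mapModel I I (fun g : G => g * 1) = ContinuousLinearMap.id ℝ E :=
      mfderiv_one_of_eq_id (by ext; simp)
    exact (congrArg _ h2).symm.trans ((DFunLike.congr_fun h v.1).symm.trans
      (DFunLike.congr_fun h3 v.1))
  have h1' : mapModel (I.prod I) I (fun p : G × G => p.1 * p.2) (0, v.2) = v.2 := by
    have h := mapModel_comp (I := I) (I' := I.prod I) (J := I)
      (χ := fun p : G × G => p.1 * p.2) (ψ := (1 : G →* G).prod (MonoidHom.id G)) rfl hm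
      (contMDiff_const.prodMk contMDiff_id).contMDiffAt
    have h2 := (homDeriv_prod_apply (I := I) (φ := (1 : G →* G)) (ψ := MonoidHom.id G)
      contMDiff_const contMDiff_id v.2).trans (Prod.ext (DFunLike.congr_fun mapModel_one v.2)
        (DFunLike.congr_fun mapModel_id v.2) : _ = ((0 : E), v.2))
    have h3 : mapModel I I (fun g : G => 1 * g) = ContinuousLinearMap.id ℝ E :=
      mfderiv_one_of_eq_id (by ext; simp)
    exact (congrArg _ h2).symm.trans ((DFunLike.congr_fun h v.2).symm.trans
      (DFunLike.congr_fun h3 v.2))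
  have h4 : v = (v.1, 0) + (0, v.2) := by simp
  conv_lhs => rw [h4]
  rw [map_add, h1, h1']

lemma mapModel_mul {G' : Type*} {E' H' : Type*} [NormedAddCommGroup E'] [NormedSpace ℝ E']
    [TopologicalSpace H'] {I' : ModelWithCorners ℝ E' H'} [TopologicalSpace G'] [ChartedSpace H' G']
    [Group G'] {α β : G' → G} (hα : ContMDiff I' I ∞ α) (hβ : ContMDiff I' I ∞ β)
    (hα1 : α 1 = 1) (hβ1 : β 1 = 1) :
    mapModel I' I (fun g => α g * β g) = mapModel I' I α + mapModel I' I β := by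
  have h := mapModel_comp (I := I') (I' := I.prod I) (J := I)
      (χ := fun p : G × G => p.1 * p.2) (ψ := fun g => (α g, β g))
      (Prod.ext hα1 hβ1) (contMDiff_mul I ∞).contMDiffAt (hα.prodMk hβ).contMDiffAt
  have h2 : mapModel I' (I.prod I) (fun g => (α g, β g))
      = (mapModel I' I α).prod (mapModel I' I β) :=
    mfderiv_prodMk (hα.contMDiffAt.mdifferentiableAt (by simp))
      (hβ.contMDiffAt.mdifferentiableAt (by simp))
  rw [h2] at h
  rw [h]
  ext x
  exact mapModel_mul_apply _

/-- Differentiate g g⁻¹ = 1. -/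
lemma mapModel_inv : mapModel I I (fun g : G => g⁻¹) = - ContinuousLinearMap.id ℝ E := by
  have h := mapModel_mul (I := I) (I' := I) (α := fun g : G => g) (β := fun g : G => g⁻¹)
    contMDiff_id (contMDiff_inv I ∞) rfl inv_one
  simp only [mul_inv_cancel, mapModel_one, mapModel_id] at h
  exact (neg_eq_of_add_eq_zero_right h.symm).symm

/-- The derivative at `1` of `g ↦ α g * s * (β g)⁻¹`. -/
lemma mapModel_twisted {G' : Type*} {E' H' : Type*} [NormedAddCommGroup E'] [NormedSpace ℝ E']
    [TopologicalSpace H'] {I' : ModelWithCorners ℝ E' H'} [TopologicalSpace G'] [ChartedSpace H' G']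
    [Group G'] {α β : G' → G} (hα : ContMDiff I' I ∞ α) (hβ : ContMDiff I' I ∞ β)
    (hα1 : α 1 = 1) (hβ1 : β 1 = 1) (s : G) (x : E') :
    mapModel I' I (fun g => α g * s * (β g)⁻¹) x
      = rightTriv I s (mapModel I' I α x - adModel I s (mapModel I' I β x)) := by
  have h1 : mapModel I' I (fun g => (β g)⁻¹) = - mapModel I' I β := by
    rw [mapModel_comp (I' := I) (χ := fun g : G => g⁻¹) hβ1 (contMDiff_inv I ∞).contMDiffAt
      hβ.contMDiffAt, mapModel_inv]
    ext; simp
  have h2 : mapModel I' I (fun g => s * (β g)⁻¹ * s⁻¹)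
      = - (adModel I s).comp (mapModel I' I β) := by
    have := mapModel_comp (I := I') (I' := I) (J := I) (χ := fun g : G => s * g * s⁻¹)
      (ψ := fun g => (β g)⁻¹) (by simp [hβ1])
      (contMDiff_conj s).contMDiffAt hβ.inv.contMDiffAt
    refine this.trans ?_
    rw [h1]
    ext x
    exact map_neg (adModel I s) _
  -- Write α s β⁻¹ = α · (s β⁻¹ s⁻¹) · s: the first two factors take the value 1 at 1, so the
  -- product rule at the identity applies, and the last is a right translation.
  have h3 := mapModel_mul (α := α) (β := fun g => s * (β g)⁻¹ * s⁻¹) hα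
    ((contMDiff_conj s).comp hβ.inv) hα1 (by simp [hβ1])
  have h4 := mapModel_comp (I := I') (I' := I) (J := I) (χ := fun k : G => k * s)
    (ψ := fun g => α g * (s * (β g)⁻¹ * s⁻¹)) (by simp [hα1, hβ1])
    (contMDiff_mul_right (a := s)).contMDiffAt
    (hα.mul ((contMDiff_conj s).comp hβ.inv)).contMDiffAt
  rw [h3, h2] at h4
  have h5 : (fun g => α g * s * (β g)⁻¹) = fun g => α g * (s * (β g)⁻¹ * s⁻¹) * s := by
    ext g; simp [mul_assoc]
  rw [h5]
  refine (DFunLike.congr_fun h4 x).trans ?_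
  change rightTriv I s (mapModel I' I α x + - adModel I s (mapModel I' I β x)) = _
  rw [← sub_eq_add_neg]

end ChainRules

/-! ### Smoothness of invariant tensor fields. -/

section InvariantTensors

variable {E H : Type*} [NormedAddCommGroup E] [NormedSpace ℝ E] [TopologicalSpace H]
  {I : ModelWithCorners ℝ E H} [I.Boundaryless] [FiniteDimensional ℝ E] {G : Type*}
  [TopologicalSpace G] [ChartedSpace H G] [Group G] [LieGroup I ∞ G]
  (r : Module.Dual ℝ (GroupLieAlgebra I G) →ₗ[ℝ] GroupLieAlgebra I G)

omit [I.Boundaryless] [LieGroup I ∞ G] in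
lemma contMDiffAt_pairing {u v : G → E →L[ℝ] ℝ} {s : G}
    (hu : ContMDiffAt I 𝓘(ℝ, E →L[ℝ] ℝ) ∞ u s) (hv : ContMDiffAt I 𝓘(ℝ, E →L[ℝ] ℝ) ∞ v s) :
    ContMDiffAt I 𝓘(ℝ, ℝ) ∞ (fun s => v s (r (u s).toLinearMap)) s := by
  let L : (E →L[ℝ] ℝ) →L[ℝ] E := LinearMap.toContinuousLinearMap
    ((show Module.Dual ℝ E →ₗ[ℝ] E from r).comp
      (LinearMap.toContinuousLinearMap (𝕜 := ℝ) (E := E) (F' := ℝ)).symm.toLinearMap)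
  exact hv.clm_apply (L.contDiff.contMDiff.contMDiffAt.comp s hu)

omit [FiniteDimensional ℝ E] in
lemma tensorBracket_leftInvariant {f g : G → ℝ} {s : G} (hf : MDifferentiableAt I 𝓘(ℝ, ℝ) f s)
    (hg : MDifferentiableAt I 𝓘(ℝ, ℝ) g s) :
    tensorBracket I (leftInvariantTensor I r) f g s
      = dOne I (fun k => g (s * k)) (r (dOne I (fun k => f (s * k))).toLinearMap) := by
  have h : (covec I f s).comp (leftTriv I s) = (dOne I (fun k => f (s * k))).toLinearMap :=
    LinearMap.ext fun x => covec_leftTriv hf x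
  rw [← h]
  exact covec_leftTriv hg _

omit [FiniteDimensional ℝ E] in
lemma tensorBracket_rightInvariant {f g : G → ℝ} {s : G} (hf : MDifferentiableAt I 𝓘(ℝ, ℝ) f s)
    (hg : MDifferentiableAt I 𝓘(ℝ, ℝ) g s) :
    tensorBracket I (rightInvariantTensor I r) f g s
      = dOne I (fun k => g (k * s)) (r (dOne I (fun k => f (k * s))).toLinearMap) := by
  have h : (covec I f s).comp (rightTriv I s) = (dOne I (fun k => f (k * s))).toLinearMap :=
    LinearMap.ext fun x => covec_rightTriv hf x
  rw [← h]
  exact covec_rightTriv hg _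

/-- The bracket given by `r^λ - r^ρ` preserves smoothness. -/
lemma contMDiffOn_tensorBracket_sub {U : Set G} {f g : G → ℝ} (hU : IsOpen U)
    (hf : ContMDiffOn I 𝓘(ℝ, ℝ) ∞ f U) (hg : ContMDiffOn I 𝓘(ℝ, ℝ) ∞ g U) :
    ContMDiffOn I 𝓘(ℝ, ℝ) ∞
      (tensorBracket I (fun s => leftInvariantTensor I r s - rightInvariantTensor I r s) f g) U := by
  have hf' : ∀ s ∈ U, ContMDiffAt I 𝓘(ℝ, ℝ) ∞ f s := fun s hs => hf.contMDiffAt (hU.mem_nhds hs)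
  have hg' : ∀ s ∈ U, ContMDiffAt I 𝓘(ℝ, ℝ) ∞ g s := fun s hs => hg.contMDiffAt (hU.mem_nhds hs)
  have h1 : ContMDiffOn I 𝓘(ℝ, ℝ) ∞ (fun s =>
      dOne I (fun k => g (s * k)) (r (dOne I (fun k => f (s * k))).toLinearMap)
      - dOne I (fun k => g (k * s)) (r (dOne I (fun k => f (k * s))).toLinearMap)) U := by
    intro s hs
    exact ((contMDiffAt_pairing r (contMDiffAt_dOne_mul_left (hf' s hs))
      (contMDiffAt_dOne_mul_left (hg' s hs))).sub
      (contMDiffAt_pairing r (contMDiffAt_dOne_mul_right (hf' s hs))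
      (contMDiffAt_dOne_mul_right (hg' s hs)))).contMDiffWithinAt
  refine h1.congr fun s hs => ?_
  have hfs := (hf' s hs).mdifferentiableAt (by simp)
  have hgs := (hg' s hs).mdifferentiableAt (by simp)
  rw [← tensorBracket_leftInvariant r hfs hgs, ← tensorBracket_rightInvariant r hfs hgs]
  exact map_sub (covec I g s) _ _

end InvariantTensors

/-! ### The bivector field of a quasi-triple. -/

section QuasiTripleBivector

variable {E H : Type*} [NormedAddCommGroup E] [NormedSpace ℝ E] [TopologicalSpace H]
  {I : ModelWithCorners ℝ E H} {G : Type*} [TopologicalSpace G] [ChartedSpace H G] [Group G]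
  {E' H' : Type*} [NormedAddCommGroup E'] [NormedSpace ℝ E'] [TopologicalSpace H']
  {I' : ModelWithCorners ℝ E' H'} {D : Type*} [TopologicalSpace D] [ChartedSpace H' D] [Group D]
  [FiniteDimensional ℝ E'] [LieGroup I' ∞ D]
  {B : LinearMap.BilinForm ℝ (GroupLieAlgebra I' D)} {ι : G →* D}
  {𝔥 : Submodule ℝ (GroupLieAlgebra I' D)}

namespace IsQuasiTriple

omit [FiniteDimensional ℝ E'] in
lemma form_Ad (hT : IsQuasiTriple I I' B ι 𝔥) (d : D) (w v : GroupLieAlgebra I' D) :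
    B w (Ad I' d v) = B (Ad I' d⁻¹ w) v := by
  have h1 : Ad I' d (Ad I' d⁻¹ w) = w := adModel_apply_inv (I := I') d w
  conv_lhs => rw [← h1]
  exact hT.invariant _ _ _

omit [FiniteDimensional ℝ E'] in
lemma comp_leftTriv (hT : IsQuasiTriple I I' B ι 𝔥) {d : D}
    {α : Module.Dual ℝ (TangentSpace I' d)} {w : GroupLieAlgebra I' D}
    (hw : α.comp (rightTriv I' d) = B w) : α.comp (leftTriv I' d) = B (Ad I' d⁻¹ w) := by
  ext v
  rw [← hT.form_Ad, ← hw]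
  exact congrArg α (leftTriv_eq (E := E') (I := I') d v)

/-- The bivector of a quasi-triple in the right trivialisation. -/
lemma bivector_apply (hT : IsQuasiTriple I I' B ι 𝔥) {d : D}
    {α : Module.Dual ℝ (TangentSpace I' d)} {w : GroupLieAlgebra I' D}
    (hw : α.comp (rightTriv I' d) = B w) :
    hT.bivector d α = rightTriv I' d (Ad I' d (hT.splitting.projMinus (Ad I' d⁻¹ w))
      - hT.splitting.projMinus w) := by
  have h1 : leftInvariantTensor I' hT.splitting.rMatrix d α
      = leftTriv I' d (hT.splitting.rMatrix (α.comp (leftTriv I' d))) := rfl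
  have h2 : rightInvariantTensor I' hT.splitting.rMatrix d α
      = rightTriv I' d (hT.splitting.rMatrix (α.comp (rightTriv I' d))) := rfl
  rw [bivector, LinearMap.sub_apply, h1, h2, hw, hT.comp_leftTriv hw,
    hT.splitting.rMatrix_form, hT.splitting.rMatrix_form, map_sub]
  exact congrArg (fun t => t - _) (leftTriv_eq (E := E') (I := I') d _)

/-- With w representing the covector, the value is ½⟨Ad_{d⁻¹} w, Ad_{d⁻¹} w⟩ − ½⟨w, w⟩, which
vanishes by invariance. -/
lemma bivector_alternating (hT : IsQuasiTriple I I' B ι 𝔥) (d : D)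
    (α : Module.Dual ℝ (TangentSpace I' d)) : α (hT.bivector d α) = 0 := by
  obtain ⟨w, hw⟩ : ∃ w, α.comp (rightTriv I' d) = B w :=
    ⟨(B.toDual hT.splitting.nondegenerate).symm (α.comp (rightTriv I' d)),
      LinearMap.ext fun v => (LinearMap.BilinForm.apply_toDual_symm_apply
        (hB := hT.splitting.nondegenerate) _ v).symm⟩
  rw [hT.bivector_apply hw]
  refine (LinearMap.congr_fun hw _).trans ?_
  rw [map_sub, hT.form_Ad, hT.splitting.form_projMinus, hT.splitting.form_projMinus,
    hT.invariant, sub_self]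

lemma isBivectorField_bivector [I'.Boundaryless] (hT : IsQuasiTriple I I' B ι 𝔥) :
    IsBivectorField I' hT.bivector where
  alternating := hT.bivector_alternating
  smooth _ _ _ hU hf hg := contMDiffOn_tensorBracket_sub _ hU hf hg

end IsQuasiTriple

end QuasiTripleBivector

/-! ### Transport of splittings and computation of their projections. -/

namespace IsIsotropicSplitting

variable {V W : Type*} [AddCommGroup V] [Module ℝ V] [AddCommGroup W] [Module ℝ W]
  {B B' : LinearMap.BilinForm ℝ V} {i i' : W →ₗ[ℝ] V} {𝔥 𝔥' : Submodule ℝ V}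

/-- Carries the splitting proved on `E × E` over to the Lie algebra of G × G, where form, embedding
and complement are known only through their values. -/
lemma congr (h : IsIsotropicSplitting B' i' 𝔥') (hB : ∀ v w, B v w = B' v w)
    (hi : ∀ x, i x = i' x) (hh : ∀ v, v ∈ 𝔥 ↔ v ∈ 𝔥') : IsIsotropicSplitting B i 𝔥 := by
  obtain rfl : B = B' := LinearMap.ext₂ hB
  obtain rfl : i = i' := LinearMap.ext hi
  obtain rfl : 𝔥 = 𝔥' := Submodule.ext hh
  exact h

lemma projPlus_projMinus_eq (h : IsIsotropicSplitting B i 𝔥) {u y : V} {x : W} (hy : y ∈ 𝔥)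
    (hu : u = i x + y) : h.projPlus u = x ∧ (h.projMinus u : V) = y := by
  have h1 : h.projPlus y = 0 := by
    apply h.injective
    have h2 := h.projPlus_add_projMinus y
    have h3 : (h.projMinus y : V) = y :=
      congrArg Subtype.val (Submodule.projectionOnto_apply_left h.isCompl.symm ⟨y, hy⟩)
    rw [h3] at h2
    rw [map_zero]
    exact add_eq_right.mp h2
  have h2 : h.projPlus u = x := by rw [hu, map_add, h.projPlus_apply, h1, add_zero]
  refine ⟨h2, ?_⟩
  have h3 := h.projPlus_add_projMinus u
  rw [h2, hu] at h3
  rw [hu]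
  exact add_left_cancel h3

end IsIsotropicSplitting

/-! ### The graphs of an orthogonal involution and of its opposite. -/

section TwistedSplitting

variable {E : Type*} [AddCommGroup E] [Module ℝ E]

/-- The graphs of an orthogonal involution and of its opposite are complementary isotropic
subspaces for the form `K ⊕ (-K)`. -/
lemma isIsotropicSplitting_graph {K : LinearMap.BilinForm ℝ E} {S : E →ₗ[ℝ] E}
    (hKs : ∀ x y, K x y = K y x) (hK : ∀ x, (∀ y, K x y = 0) → x = 0)
    (hS : ∀ x, S (S x) = x) (hKS : ∀ x y, K (S x) (S y) = K x y) :
    IsIsotropicSplitting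
      (K.comp (LinearMap.fst ℝ E E) (LinearMap.fst ℝ E E)
        - K.comp (LinearMap.snd ℝ E E) (LinearMap.snd ℝ E E))
      (LinearMap.id.prod S) (LinearMap.range (LinearMap.id.prod (-S))) where
  symm := ⟨fun v w => by simp [hKs v.1, hKs v.2]⟩
  nondegenerate := by
    have h1 : ∀ v : E × E, (∀ w : E × E, K v.1 w.1 - K v.2 w.2 = 0) → v = 0 := by
      intro v hv
      refine Prod.ext (hK _ fun y => ?_) (hK _ fun y => ?_)
      · simpa using hv (y, 0)
      · simpa using hv (0, y)
    refine ⟨fun v hv => h1 v hv, fun v hv => h1 v fun w => ?_⟩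
    have h2 : K w.1 v.1 - K w.2 v.2 = 0 := hv w
    rwa [hKs v.1, hKs v.2]
  injective x y hxy := congrArg Prod.fst hxy
  isotropic_range x y := by simp [hKS]
  isotropic_compl := by
    rintro _ ⟨x, rfl⟩ _ ⟨y, rfl⟩
    simp [hKS]
  isCompl := by
    refine ⟨Submodule.disjoint_def.mpr ?_, codisjoint_iff.mpr (eq_top_iff.mpr fun v _ => ?_)⟩
    · rintro _ ⟨x, rfl⟩ ⟨y, hy⟩
      have h1 : y = x := congrArg Prod.fst hy
      have h2 : - S y = S x := congrArg Prod.snd hy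
      have h3 : x = 0 := by
        have h4 : S x = 0 := by
          rw [h1] at h2
          calc S x = (1 / 2 : ℝ) • (S x + S x) := by module
            _ = (1 / 2 : ℝ) • (- S x + S x) := by rw [h2]
            _ = 0 := by simp
        rw [← hS x, h4, map_zero]
      rw [h3, map_zero]
    -- Solving v = (x, S x) + (y, −S y) with S² = 1 gives x = ½(v₁ + S v₂) and y = ½(v₁ − S v₂).
    · refine Submodule.mem_sup.mpr ⟨_, ⟨(1 / 2 : ℝ) • (v.1 + S v.2), rfl⟩, _,
        ⟨(1 / 2 : ℝ) • (v.1 - S v.2), rfl⟩, ?_⟩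
      refine Prod.ext ?_ ?_
      · change (1 / 2 : ℝ) • (v.1 + S v.2) + (1 / 2 : ℝ) • (v.1 - S v.2) = v.1
        module
      · change S ((1 / 2 : ℝ) • (v.1 + S v.2)) + - S ((1 / 2 : ℝ) • (v.1 - S v.2)) = v.2
        simp only [map_smul, map_add, map_sub, hS]
        module

end TwistedSplitting

/-! ### The twisted quasi-triple. -/

section TwistedDouble

variable {E H : Type*} [NormedAddCommGroup E] [NormedSpace ℝ E] [TopologicalSpace H]
  {I : ModelWithCorners ℝ E H} {G : Type*}
  [TopologicalSpace G] [ChartedSpace H G] [Group G]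
  {K : LinearMap.BilinForm ℝ (GroupLieAlgebra I G)} {σ : G →* G}

lemma doubleForm_apply (K : LinearMap.BilinForm ℝ (GroupLieAlgebra I G)) (v w : E × E) :
    doubleForm I K v w = K v.1 w.1 - K v.2 w.2 := by
  have h1 : doubleForm I K v w
    = K (lieFst I G v) (lieFst I G w) - K (lieSnd I G v) (lieSnd I G w) := rfl
  rw [h1, lieFst_apply, lieFst_apply, lieSnd_apply, lieSnd_apply]

lemma mapModel_involutive (hσ : ContMDiff I I ∞ σ) (hσσ : ∀ g, σ (σ g) = g) (x : E) :
    mapModel I I σ (mapModel I I σ x) = x := by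
  have h := mapModel_comp (I := I) (I' := I) (J := I) (map_one σ) hσ.contMDiffAt hσ.contMDiffAt
  simp only [hσσ, mapModel_id] at h
  exact (DFunLike.congr_fun h x).symm

lemma mem_gMinus {v : E × E} : (v : GroupLieAlgebra (I.prod I) (G × G)) ∈ gMinus I σ
    ↔ ∃ x : E, (x, - mapModel I I σ x) = v :=
  exists_congr fun x => by
    have := twistedAntidiag_apply (I := I) σ x
    exact ⟨fun h => this.symm.trans h, fun h => this.trans h⟩

lemma isIsotropicSplitting_twisted (hKs : K.IsSymm) (hK : K.Nondegenerate)
    (hσ : ContMDiff I I ∞ σ) (hσσ : ∀ g, σ (σ g) = g)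
    (hσK : ∀ x y : GroupLieAlgebra I G, K (homDeriv I I σ x) (homDeriv I I σ y) = K x y) :
    IsIsotropicSplitting (doubleForm I K) (homDeriv I (I.prod I) (twistedDiag σ))
      (gMinus I σ) := by
  have h := isIsotropicSplitting_graph (E := E) (K := K) (S := (mapModel I I σ).toLinearMap)
    hKs.eq hK.1 (mapModel_involutive hσ hσσ) hσK
  exact IsIsotropicSplitting.congr (V := GroupLieAlgebra (I.prod I) (G × G))
    (W := GroupLieAlgebra I G) h (doubleForm_apply (E := E) K) (homDeriv_twistedDiag (E := E) hσ)
    (fun v => mem_gMinus (E := E))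

variable [LieGroup I ∞ G]

lemma isQuasiTriple_twisted [T1Space H] [ConnectedSpace G] (hKs : K.IsSymm) (hK : K.Nondegenerate)
    (hKAd : ∀ (g : G) (x y : GroupLieAlgebra I G), K (Ad I g x) (Ad I g y) = K x y)
    (hσ : ContMDiff I I ∞ σ) (hσσ : ∀ g, σ (σ g) = g)
    (hσK : ∀ x y : GroupLieAlgebra I G, K (homDeriv I I σ x) (homDeriv I I σ y) = K x y) :
    IsQuasiTriple I (I.prod I) (doubleForm I K) (twistedDiag σ) (gMinus I σ) where
  connected_group := inferInstance
  connected_subgroup := inferInstance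
  smooth := contMDiff_id.prodMk hσ
  isClosedEmbedding := by
    -- Closedness of the graph of σ needs G Hausdorff: points are closed because G is locally
    -- modelled on a T1 space, and a T1 topological group is Hausdorff.
    have : IsTopologicalGroup G := topologicalGroup_of_lieGroup I ∞
    have : T1Space G := ChartedSpace.t1Space H G
    exact Function.LeftInverse.isClosedEmbedding (f := Prod.fst) (fun _ => rfl) continuous_fst
      (continuous_id.prodMk hσ.continuous)
  invariant d x y := by
    have h1 := adModel_prod (I := I) d x
    have h2 := adModel_prod (I := I) d y
    have h3 : doubleForm I K (Ad (I.prod I) d x) (Ad (I.prod I) d y)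
      = doubleForm I K (adModel (I.prod I) d x) (adModel (I.prod I) d y) := rfl
    rw [h3, h1, h2]
    refine (doubleForm_apply K _ _).trans (Eq.trans ?_ (doubleForm_apply K x y).symm)
    exact congrArg₂ (fun a b : ℝ => a - b) (hKAd d.1 _ _) (hKAd d.2 _ _)
  splitting := isIsotropicSplitting_twisted hKs hK hσ hσσ hσK

end TwistedDouble

/-! ### The maps j, φ and F of the twisted quasi-triple. -/

section TwistedQuasiTriple

variable {E H : Type*} [NormedAddCommGroup E] [NormedSpace ℝ E] [TopologicalSpace H]
  {I : ModelWithCorners ℝ E H} {G : Type*}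
  [TopologicalSpace G] [ChartedSpace H G] [Group G]
  {K : LinearMap.BilinForm ℝ (GroupLieAlgebra I G)} {σ : G →* G}

lemma projMinus_twisted (hσ : ContMDiff I I ∞ σ) (hσσ : ∀ g, σ (σ g) = g)
    (h : IsIsotropicSplitting (doubleForm I K) (homDeriv I (I.prod I) (twistedDiag σ))
      (gMinus I σ)) (u : E × E) :
    (h.projMinus u : GroupLieAlgebra (I.prod I) (G × G))
      = (((1 / 2 : ℝ) • (u.1 - mapModel I I σ u.2),
        - mapModel I I σ ((1 / 2 : ℝ) • (u.1 - mapModel I I σ u.2))) : E × E) := by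
  have hS := mapModel_involutive (I := I) hσ hσσ
  refine (h.projPlus_projMinus_eq (x := ((1 / 2 : ℝ) • (u.1 + mapModel I I σ u.2) : E))
    (mem_gMinus.mpr ⟨_, rfl⟩) ?_).2
  refine Eq.trans ?_ (congrArg (fun t : E × E => t + ((1 / 2 : ℝ) • (u.1 - mapModel I I σ u.2),
    - mapModel I I σ ((1 / 2 : ℝ) • (u.1 - mapModel I I σ u.2)))) (homDeriv_twistedDiag hσ _)).symm
  refine Prod.ext ?_ ?_
  · change u.1 = (1 / 2 : ℝ) • (u.1 + mapModel I I σ u.2)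
      + (1 / 2 : ℝ) • (u.1 - mapModel I I σ u.2)
    module
  · change u.2 = mapModel I I σ ((1 / 2 : ℝ) • (u.1 + mapModel I I σ u.2))
      + - mapModel I I σ ((1 / 2 : ℝ) • (u.1 - mapModel I I σ u.2))
    simp only [map_smul, map_add, map_sub, hS]
    module

lemma j_twisted [FiniteDimensional ℝ E] (hσ : ContMDiff I I ∞ σ)
    (hσK : ∀ x y : GroupLieAlgebra I G, K (homDeriv I I σ x) (homDeriv I I σ y) = K x y)
    (h : IsIsotropicSplitting (doubleForm I K) (homDeriv I (I.prod I) (twistedDiag σ))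
      (gMinus I σ)) (a : E) :
    (h.j (K a) : GroupLieAlgebra (I.prod I) (G × G))
      = (((1 / 2 : ℝ) • a, - mapModel I I σ ((1 / 2 : ℝ) • a)) : E × E) := by
  refine congrArg Subtype.val (h.j_eq (y := ⟨_, mem_gMinus.mpr ⟨(1 / 2 : ℝ) • a, rfl⟩⟩)
    fun x => ?_)
  refine (congrArg _ (homDeriv_twistedDiag (E := E) hσ x)).trans
    ((doubleForm_apply K _ _).trans ?_)
  have h1 : ∀ (k : LinearMap.BilinForm ℝ E) (S : E →L[ℝ] E) (_ : ∀ u v, k (S u) (S v) = k u v)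
      (x : E), k ((1 / 2 : ℝ) • a) x - k (- S ((1 / 2 : ℝ) • a)) (S x) = k a x := by
    intro k S hS x
    simp only [map_neg, LinearMap.neg_apply, hS, map_smul, LinearMap.smul_apply, smul_eq_mul]
    ring
  exact h1 K (mapModel I I σ) hσK x

variable [LieGroup I ∞ G] [I.Boundaryless] [FiniteDimensional ℝ E]

/-- The two minus signs in the second component cancel and σ preserves brackets, so the bracket lies
on the graph of σ. The factor 1/4 is the square of the 1/2 in `j_twisted`. This gives both φ and F =
0. -/
lemma lie_j_twisted (hσ : ContMDiff I I ∞ σ)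
    (hσK : ∀ x y : GroupLieAlgebra I G, K (homDeriv I I σ x) (homDeriv I I σ y) = K x y)
    (h : IsIsotropicSplitting (doubleForm I K) (homDeriv I (I.prod I) (twistedDiag σ))
      (gMinus I σ)) (a b : E) :
    ⁅(h.j (K a) : GroupLieAlgebra (I.prod I) (G × G)),
      (h.j (K b) : GroupLieAlgebra (I.prod I) (G × G))⁆
      = homDeriv I (I.prod I) (twistedDiag σ)
        ((1 / 4 : ℝ) • lieBilin I G a b : E) := by
  have e := homDeriv_twistedDiag (E := E) hσ ((1 / 4 : ℝ) • lieBilin I G a b : E)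
  refine Eq.trans ?_ e.symm
  rw [j_twisted hσ hσK h a, j_twisted hσ hσK h b]
  refine (lieModel_prod (I := I) (G := G) _ _).trans (Prod.ext ?_ ?_)
  · change lieBilin I G ((1 / 2 : ℝ) • a) ((1 / 2 : ℝ) • b) = _
    simp only [map_smul, LinearMap.smul_apply, smul_smul]
    norm_num
  · change lieBilin I G (- mapModel I I σ ((1 / 2 : ℝ) • a)) (- mapModel I I σ ((1 / 2 : ℝ) • b))
      = mapModel I I σ ((1 / 4 : ℝ) • lieBilin I G a b)
    rw [map_smul (mapModel I I σ) (1 / 4 : ℝ), lieBilin_apply a b, mapModel_lieModel hσ, ← lieBilin_apply]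
    simp only [map_smul, map_neg, LinearMap.smul_apply, LinearMap.neg_apply]
    module

lemma phi_twisted (hσ : ContMDiff I I ∞ σ)
    (hσK : ∀ x y : GroupLieAlgebra I G, K (homDeriv I I σ x) (homDeriv I I σ y) = K x y)
    (hT : IsQuasiTriple I (I.prod I) (doubleForm I K) (twistedDiag σ) (gMinus I σ)) (a b c : E) :
    hT.phi (K a) (K b) (K c) = (1 / 4 : ℝ) * K c (lieBilin I G a b : E) := by
  unfold IsQuasiTriple.phi
  rw [lie_j_twisted hσ hσK hT.splitting]
  exact (congrArg (K c) (hT.splitting.projPlus_apply _)).trans (map_smul (K c) (1 / 4 : ℝ) _)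

lemma cobracket_twisted (hσ : ContMDiff I I ∞ σ)
    (hσK : ∀ x y : GroupLieAlgebra I G, K (homDeriv I I σ x) (homDeriv I I σ y) = K x y)
    (hT : IsQuasiTriple I (I.prod I) (doubleForm I K) (twistedDiag σ) (gMinus I σ)) (a b : E)
    (x : GroupLieAlgebra I G) :
    hT.cobracket x (K a) (K b) = 0 := by
  unfold IsQuasiTriple.cobracket
  rw [lie_j_twisted hσ hσK hT.splitting]
  have h : hT.splitting.projMinus (homDeriv I (I.prod I) (twistedDiag σ)
        ((1 / 4 : ℝ) • lieBilin I G a b : E)) = 0 :=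
    Submodule.projectionOnto_apply_of_mem_right hT.splitting.isCompl.symm ⟨_, rfl⟩
  rw [h, map_zero]
  rfl

end TwistedQuasiTriple

/-! ### The quotient map (a, b) ↦ a b⁻¹. -/

section Quotient

variable {E H : Type*} [NormedAddCommGroup E] [NormedSpace ℝ E] [TopologicalSpace H]
  {I : ModelWithCorners ℝ E H} {G : Type*}
  [TopologicalSpace G] [ChartedSpace H G] [Group G] [LieGroup I ∞ G]

lemma contMDiff_mul_snd_inv : ContMDiff (I.prod I) I ∞ (fun d : G × G => d.1 * d.2⁻¹) :=
  contMDiff_fst.mul contMDiff_snd.inv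

/-- Precomposed with right translation by d, the quotient map becomes h ↦ h₁ s h₂⁻¹ with s = d₁
d₂⁻¹, an instance of `mapModel_twisted`. -/
lemma tangentLin_mul_snd_inv (d : G × G) (v : E × E) :
    tangentLin (I.prod I) I (fun d : G × G => d.1 * d.2⁻¹) d (rightTriv (I.prod I) d v)
      = rightTriv I (d.1 * d.2⁻¹) (v.1 - adModel I (d.1 * d.2⁻¹) v.2) := by
  have h1 := tangentLin_mapModel (I := I.prod I) (J := I.prod I) (J' := I)
    (F := fun d : G × G => d.1 * d.2⁻¹) (χ := fun h : G × G => h * d) (one_mul d)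
    (contMDiff_mul_snd_inv.contMDiffAt.mdifferentiableAt (by simp))
    ((contMDiff_mul_right (I := I.prod I) (n := ∞)).contMDiffAt.mdifferentiableAt (by simp)) v
  refine h1.trans ?_
  have h2 : (fun h : G × G => (h * d).1 * (h * d).2⁻¹)
      = fun h => h.1 * (d.1 * d.2⁻¹) * h.2⁻¹ := by
    ext h; simp [mul_assoc]
  rw [h2]
  have h3 := mapModel_twisted (I := I) (I' := I.prod I) (α := (Prod.fst : G × G → G))
    (β := (Prod.snd : G × G → G)) contMDiff_fst contMDiff_snd rfl rfl (d.1 * d.2⁻¹) v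
  rw [mapModel_fst, mapModel_snd] at h3
  exact h3

lemma isQuotientBy_mul_snd_inv :
    IsQuotientBy (I.prod I) I (fun d : G × G => d.1 * d.2⁻¹)
      (twistedDiag (MonoidHom.id G)).range where
  smooth := contMDiff_mul_snd_inv
  surjective s := ⟨(s, 1), by simp⟩
  submersion d y := by
    obtain ⟨x, hx⟩ := rightTriv_surjective (I := I) (d.1 * d.2⁻¹) y
    refine ⟨rightTriv (I.prod I) d ((x, 0) : E × E), ?_⟩
    have h0 : ∀ x : E, x - adModel I (d.1 * d.2⁻¹) (0 : E) = x := fun x => by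
      rw [map_zero, sub_zero]
    exact (tangentLin_mul_snd_inv (E := E) d (x, 0)).trans
      ((congrArg (rightTriv I (d.1 * d.2⁻¹)) (h0 x)).trans hx)
  fibre d d' := by
    constructor
    · intro h
      refine ⟨d.1⁻¹ * d'.1, Prod.ext rfl ?_⟩
      change d.1⁻¹ * d'.1 = d.2⁻¹ * d'.2
      have h' : d.1 * d.2⁻¹ = d'.1 * d'.2⁻¹ := h
      rw [inv_mul_eq_iff_eq_mul, ← mul_assoc, h', inv_mul_cancel_right]
    · rintro ⟨g, hg⟩
      have h1 : g = d.1⁻¹ * d'.1 := congrArg Prod.fst hg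
      have h2 : g = d.2⁻¹ * d'.2 := congrArg Prod.snd hg
      change d.1 * d.2⁻¹ = d'.1 * d'.2⁻¹
      have h3 : d'.1 = d.1 * g := by rw [h1, mul_inv_cancel_left]
      have h4 : d'.2 = d.2 * g := by rw [h2, mul_inv_cancel_left]
      rw [h3, h4]
      group

end Quotient

/-! ### The bivector field on S and its iterated brackets. -/

section TwistedBivector

open Filter Topology

variable {E H : Type*} [NormedAddCommGroup E] [NormedSpace ℝ E] [TopologicalSpace H]
  {I : ModelWithCorners ℝ E H} {G : Type*}
  [TopologicalSpace G] [ChartedSpace H G] [Group G] [FiniteDimensional ℝ E]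

omit [Group G] [FiniteDimensional ℝ E] in
lemma covec_congr {u u' : G → ℝ} {s : G} (hu : u =ᶠ[𝓝 s] u') : covec I u s = covec I u' s :=
  LinearMap.ext fun v => DFunLike.congr_fun (hu.mfderiv_eq (I := I) (I' := 𝓘(ℝ, ℝ))) v

/-- The inverse `S ∘ Ad_{s⁻¹}` of `Ad_s ∘ S`. -/
def twistedAdInv (I : ModelWithCorners ℝ E H) (S : E →L[ℝ] E) (s : G) : E →L[ℝ] E :=
  S.comp (adModel I s⁻¹)

/-- The operator `½ (A⁻¹ - A)`, for `A = Ad_s ∘ S`. -/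
def twistedOp (I : ModelWithCorners ℝ E H) (S : E →L[ℝ] E) (s : G) (x : E) : E :=
  (1 / 2 : ℝ) • (twistedAdInv I S s x - twistedAd I S s x)

/-- The bivector field which is `½ (Ad_{σ(s)⁻¹} - Ad_s) ∘ σ ∘ K⁻¹` in the right
trivialisation. -/
def twistedBivector {K : LinearMap.BilinForm ℝ (GroupLieAlgebra I G)} (hK : K.Nondegenerate)
    (σ : G →* G) : TwoTensorField I G := fun s =>
  (rightTriv I s).comp (((1 / 2 : ℝ) • ((Ad I (σ s)⁻¹ - Ad I s).comp (homDeriv I I σ))).comp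
    ((K.toDual hK).symm.toLinearMap.comp (LinearMap.lcomp ℝ ℝ (rightTriv I s))))

variable [LieGroup I ∞ G] {σ : G →* G} (hσ : ContMDiff I I ∞ σ)

include hσ in
omit [FiniteDimensional ℝ E] in
lemma twistedAdInv_apply (s : G) (x : E) :
    twistedAdInv I (mapModel I I σ) s x = adModel I (σ s)⁻¹ (mapModel I I σ x) := by
  have h := DFunLike.congr_fun (mapModel_adModel (I := I) (I' := I) hσ s⁻¹) x
  rw [map_inv] at h
  exact h

include hσ in
lemma twistedBivector_apply {K : LinearMap.BilinForm ℝ (GroupLieAlgebra I G)}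
    (hK : K.Nondegenerate) (s : G) (α : Module.Dual ℝ (TangentSpace I s)) :
    twistedBivector hK σ s α = rightTriv I s (twistedOp (E := E) I (mapModel I I σ) s
      ((K.toDual hK).symm (α.comp (rightTriv I s)))) := by
  refine congrArg (rightTriv I s) ?_
  have h := twistedAdInv_apply (E := E) hσ s ((K.toDual hK).symm (α.comp (rightTriv I s)))
  unfold twistedOp
  rw [h]
  rfl

variable {K : LinearMap.BilinForm ℝ E} (hK : K.Nondegenerate) (hKs : ∀ x y, K x y = K y x)
  (hKAd : ∀ (g : G) (x y : E), K (adModel I g x) (adModel I g y) = K x y)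
  (hσσ : ∀ g, σ (σ g) = g)
  (hσK : ∀ x y : E, K (mapModel I I σ x) (mapModel I I σ y) = K x y)

include hKs hKAd hσ hσσ hσK in
lemma isOrthogonalTwist_twistedAd [I.Boundaryless] (s : G) :
    IsOrthogonalTwist K (lieBilin I G) (twistedAd I (mapModel I I σ) s).toLinearMap
      (twistedAdInv I (mapModel I I σ) s).toLinearMap where
  symm := hKs
  skew := lieModel_skew
  invariant := form_lieModel hKAd
  orthogonal x y := (hKAd s _ _).trans (hσK x y)
  map_br x y := by
    change adModel I s (mapModel I I σ (lieModel I G x y)) = _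
    rw [mapModel_lieModel hσ, adModel_lieModel]
    rfl
  apply_inv x := by
    change adModel I s (mapModel I I σ (mapModel I I σ (adModel I s⁻¹ x))) = x
    rw [mapModel_involutive hσ hσσ, adModel_apply_inv]

omit [FiniteDimensional ℝ E] [LieGroup I ∞ G] in
lemma form_twistedOp {S : E →L[ℝ] E} {s : G} {br : E →ₗ[ℝ] E →ₗ[ℝ] E}
    (h : IsOrthogonalTwist K br (twistedAd I S s).toLinearMap (twistedAdInv I S s).toLinearMap)
    (x y : E) : K y (twistedOp I S s x)
      = (1 / 2 : ℝ) * (K (twistedAd I S s y) x - K (twistedAd I S s x) y) := by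
  have h1 := h.adjoint y x
  have h2 := h.symm (twistedAd I S s x) y
  simp only [ContinuousLinearMap.coe_coe] at h1
  simp only [twistedOp, map_smul, map_sub, smul_eq_mul]
  rw [h1, h2]

omit [FiniteDimensional ℝ E] [LieGroup I ∞ G] in
-- The K-adjoint of A is A⁻¹, so ½(A⁻¹ − A) is skew.
lemma form_twistedOp_skew {S : E →L[ℝ] E} {s : G} {br : E →ₗ[ℝ] E →ₗ[ℝ] E}
    (h : IsOrthogonalTwist K br (twistedAd I S s).toLinearMap (twistedAdInv I S s).toLinearMap)
    (x y : E) : K y (twistedOp I S s x) = - K x (twistedOp I S s y) := by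
  rw [form_twistedOp h, form_twistedOp h]
  ring

variable [I.Boundaryless]

include hσ in
lemma tensorBracket_twistedBivector {f g : G → ℝ} {s : G}
    (hf : MDifferentiableAt I 𝓘(ℝ, ℝ) f s) (hg : MDifferentiableAt I 𝓘(ℝ, ℝ) g s) :
    tensorBracket I (twistedBivector (I := I) hK σ) f g s
      = K (rightGrad I hK g s) (twistedOp I (mapModel I I σ) s (rightGrad I hK f s)) := by
  have h1 : (covec I f s).comp (rightTriv I s) = (dOne I (fun k => f (k * s))).toLinearMap :=
    LinearMap.ext fun x => covec_rightTriv hf x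
  have h2 := twistedBivector_apply (I := I) hσ hK s (covec I f s)
  rw [h1] at h2
  refine (congrArg (covec I g s) h2).trans ((covec_rightTriv hg _).trans ?_)
  exact (apply_rightGrad hK g s _).symm

include hσ in
lemma tensorBracket_eq_dOne {f g : G → ℝ} {s : G}
    (hf : MDifferentiableAt I 𝓘(ℝ, ℝ) f s) (hg : MDifferentiableAt I 𝓘(ℝ, ℝ) g s) :
    tensorBracket I (twistedBivector (I := I) hK σ) f g s = dOne I (fun k => g (k * s))
      (twistedOp I (mapModel I I σ) s (rightGrad I hK f s)) := by
  rw [tensorBracket_twistedBivector hσ hK hf hg, apply_rightGrad]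

include hKs hKAd hσσ hσK hσ

/-- Antisymmetry lets the derivative fall on the first function, the form needed when that function
is itself a bracket or a derivative along the action. -/
lemma tensorBracket_eq_neg_dOne {f g : G → ℝ} {s : G}
    (hf : MDifferentiableAt I 𝓘(ℝ, ℝ) f s) (hg : MDifferentiableAt I 𝓘(ℝ, ℝ) g s) :
    tensorBracket I (twistedBivector (I := I) hK σ) f g s
      = - dOne I (fun k => f (k * s)) (twistedOp I (mapModel I I σ) s (rightGrad I hK g s)) := by
  rw [tensorBracket_twistedBivector hσ hK hf hg,
    form_twistedOp_skew (isOrthogonalTwist_twistedAd hσ hKs hKAd hσσ hσK s), apply_rightGrad]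

lemma tensorBracket_eq_twistedBracket {f g : G → ℝ} {s : G}
    (hf : MDifferentiableAt I 𝓘(ℝ, ℝ) f s) (hg : MDifferentiableAt I 𝓘(ℝ, ℝ) g s) :
    tensorBracket I (twistedBivector (I := I) hK σ) f g s
      = twistedBracket I hK (mapModel I I σ) f g s := by
  rw [tensorBracket_twistedBivector hσ hK hf hg,
    form_twistedOp (isOrthogonalTwist_twistedAd hσ hKs hKAd hσσ hσK s)]
  rfl

lemma isBivectorField_twistedBivector :
    IsBivectorField I (twistedBivector (I := I) (G := G) hK σ) where
  alternating s α := by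
    let a : E := (K.toDual hK).symm (α.comp (rightTriv I s))
    have h1 : ∀ x : E, α (rightTriv I s x) = K a x := fun x =>
      (LinearMap.BilinForm.apply_toDual_symm_apply (hB := hK)
        (show Module.Dual ℝ E from α.comp (rightTriv I s)) x).symm
    refine (congrArg α (twistedBivector_apply (I := I) hσ hK s α)).trans ((h1 _).trans ?_)
    have h2 : K a (twistedOp I (mapModel I I σ) s a) = 0 := by
      linarith [form_twistedOp_skew (isOrthogonalTwist_twistedAd hσ hKs hKAd hσσ hσK s) a a]
    exact h2
  smooth U f g hU hf hg := by
    have hf' : ∀ s ∈ U, ContMDiffAt I 𝓘(ℝ, ℝ) ∞ f s := fun s hs => hf.contMDiffAt (hU.mem_nhds hs)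
    have hg' : ∀ s ∈ U, ContMDiffAt I 𝓘(ℝ, ℝ) ∞ g s := fun s hs => hg.contMDiffAt (hU.mem_nhds hs)
    have h1 : ContMDiffOn I 𝓘(ℝ, ℝ) ∞ (twistedBracket I hK (mapModel I I σ) f g) U := fun s hs =>
      (contMDiffAt_twistedBracket hK _ (hf' s hs) (hg' s hs)).contMDiffWithinAt
    exact h1.congr fun s hs => tensorBracket_eq_twistedBracket hσ hK hKs hKAd hσσ hσK
      ((hf' s hs).mdifferentiableAt (by simp)) ((hg' s hs).mdifferentiableAt (by simp))

/-- A covector depends only on the germ of its function, so nested brackets may be computed with the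
explicit formula near s. -/
lemma tensorBracket_eventuallyEq {f g : G → ℝ} {U : Set G} {s : G} (hU : IsOpen U) (hs : s ∈ U)
    (hf : ContMDiffOn I 𝓘(ℝ, ℝ) ∞ f U) (hg : ContMDiffOn I 𝓘(ℝ, ℝ) ∞ g U) :
    tensorBracket I (twistedBivector (I := I) hK σ) f g =ᶠ[𝓝 s]
      twistedBracket I hK (mapModel I I σ) f g := by
  filter_upwards [hU.mem_nhds hs] with t ht
  exact tensorBracket_eq_twistedBracket hσ hK hKs hKAd hσσ hσK
    ((hf.contMDiffAt (hU.mem_nhds ht)).mdifferentiableAt (by simp))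
    ((hg.contMDiffAt (hU.mem_nhds ht)).mdifferentiableAt (by simp))

lemma tensorBracket_tensorBracket {f g h : G → ℝ} {U : Set G} {s : G} (hU : IsOpen U) (hs : s ∈ U)
    (hf : ContMDiffOn I 𝓘(ℝ, ℝ) ∞ f U) (hg : ContMDiffOn I 𝓘(ℝ, ℝ) ∞ g U)
    (hh : ContMDiffOn I 𝓘(ℝ, ℝ) ∞ h U) :
    tensorBracket I (twistedBivector (I := I) hK σ)
      (tensorBracket I (twistedBivector (I := I) hK σ) f g) h s
      = - twistDeriv K (lieBilin I G) (twistedAd I (mapModel I I σ) s).toLinearMap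
        (rightGrad I hK f s) (rightGrad I hK g s) (rightHess I hK f s) (rightHess I hK g s)
        (twistedOp I (mapModel I I σ) s (rightGrad I hK h s)) := by
  have hev := tensorBracket_eventuallyEq hσ hK hKs hKAd hσσ hσK hU hs hf hg
  have hfs := hf.contMDiffAt (hU.mem_nhds hs)
  have hgs := hg.contMDiffAt (hU.mem_nhds hs)
  have hhs := hh.contMDiffAt (hU.mem_nhds hs)
  rw [tensorBracket, covec_congr hev, ← tensorBracket, tensorBracket_eq_neg_dOne hσ hK hKs hKAd hσσ hσK
    ((contMDiffAt_twistedBracket hK _ hfs hgs).mdifferentiableAt (by simp))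
    (hhs.mdifferentiableAt (by simp)),
    dOne_twistedBracket hK _ hfs hgs (br := lieBilin I G) (fun _ _ => rfl)]

end TwistedBivector

/-! ### Projection of P_D to S. -/

section Projection

variable {E H : Type*} [NormedAddCommGroup E] [NormedSpace ℝ E] [TopologicalSpace H]
  {I : ModelWithCorners ℝ E H} {G : Type*}
  [TopologicalSpace G] [ChartedSpace H G] [Group G] [FiniteDimensional ℝ E] [LieGroup I ∞ G]
  {σ : G →* G}

omit [FiniteDimensional ℝ E] in
/-- The linear algebra behind the projection of the bivector of the twisted quasi-triple. -/
lemma projMinus_twisted_sub {K : LinearMap.BilinForm ℝ (GroupLieAlgebra I G)}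
    (hσ : ContMDiff I I ∞ σ) (hσσ : ∀ g, σ (σ g) = g)
    (h : IsIsotropicSplitting (doubleForm I K) (homDeriv I (I.prod I) (twistedDiag σ))
      (gMinus I σ)) (d : G × G) (b : E) {u : E × E}
    (hu : u = adModel (I.prod I) d (h.projMinus (adModel (I.prod I) d⁻¹
      (b, adModel I (d.1 * d.2⁻¹)⁻¹ b))).1
      - (show E × E from (h.projMinus ((b, adModel I (d.1 * d.2⁻¹)⁻¹ b) : E × E)).1)) :
    u.1 - adModel I (d.1 * d.2⁻¹) u.2 = twistedOp I (mapModel I I σ) (d.1 * d.2⁻¹) b := by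
  have hS := mapModel_involutive (I := I) hσ hσσ
  set c : E := adModel I d.1⁻¹ b with hc
  -- The vector representing a covector pulled back from S becomes diagonal after Ad_{d⁻¹}, the
  -- diagonal being its own orthogonal for the form.
  have h1 : adModel I d.2⁻¹ (adModel I (d.1 * d.2⁻¹)⁻¹ b) = c := by
    have := DFunLike.congr_fun (adModel_mul (I := I) d.2⁻¹ (d.1 * d.2⁻¹)⁻¹) b
    refine this.symm.trans ?_
    rw [mul_inv_rev, inv_inv, inv_mul_cancel_left]
  have h2 : adModel (I.prod I) d⁻¹ (b, adModel I (d.1 * d.2⁻¹)⁻¹ b) = (c, c) :=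
    (adModel_prod _ _).trans (Prod.ext rfl h1)
  have h3 : ∀ x : E, adModel I (d.1 * d.2⁻¹) (adModel I d.2 x) = adModel I d.1 x := by
    intro x
    refine (DFunLike.congr_fun (adModel_mul (I := I) (d.1 * d.2⁻¹) d.2) x).symm.trans ?_
    rw [inv_mul_cancel_right]
  have h4 := projMinus_twisted hσ hσσ h (c, c)
  have h5 := projMinus_twisted hσ hσσ h (b, adModel I (d.1 * d.2⁻¹)⁻¹ b)
  set S := mapModel I I σ with hS'
  set s := d.1 * d.2⁻¹ with hs
  have h6 : adModel (I.prod I) d ((1 / 2 : ℝ) • (c - S c), - S ((1 / 2 : ℝ) • (c - S c)))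
      = (adModel I d.1 ((1 / 2 : ℝ) • (c - S c)),
        adModel I d.2 (- S ((1 / 2 : ℝ) • (c - S c)))) := adModel_prod _ _
  have h7 : u = (adModel I d.1 ((1 / 2 : ℝ) • (c - S c)) - (1 / 2 : ℝ) • (b - S (adModel I s⁻¹ b)),
      adModel I d.2 (- S ((1 / 2 : ℝ) • (c - S c)))
        - - S ((1 / 2 : ℝ) • (b - S (adModel I s⁻¹ b)))) := by
    rw [hu, h2]
    exact (congrArg₂ (fun x y : E × E => adModel (I.prod I) d x - y) h4 h5).trans
      (congrArg (fun x : E × E => x - _) h6)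
  rw [h7]
  change _ - _ - adModel I s (_ - - _) = (1 / 2 : ℝ) • (S (adModel I s⁻¹ b) - adModel I s (S b))
  -- The terms with Ad_{d₁} come from r^λ and cancel, as σ changes the sign of c − σ c; those left
  -- involve s and b only.
  rw [map_sub (adModel I s), h3]
  simp only [map_neg, map_smul, map_sub, hS, adModel_apply_inv]
  module

lemma projectsTo_twistedBivector {K : LinearMap.BilinForm ℝ (GroupLieAlgebra I G)}
    (hK : K.Nondegenerate) (hσ : ContMDiff I I ∞ σ) (hσσ : ∀ g, σ (σ g) = g)
    (hKAd : ∀ (g : G) (x y : GroupLieAlgebra I G), K (Ad I g x) (Ad I g y) = K x y)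
    (hT : IsQuasiTriple I (I.prod I) (doubleForm I K) (twistedDiag σ) (gMinus I σ)) :
    ProjectsTo (I.prod I) I (fun d : G × G => d.1 * d.2⁻¹) hT.bivector
      (twistedBivector hK σ) := by
  intro d β
  let b : E := (K.toDual hK).symm (β.comp (rightTriv I (d.1 * d.2⁻¹)))
  have hb : ∀ x : E, β (rightTriv I (d.1 * d.2⁻¹) x) = K b x := fun x =>
    (LinearMap.BilinForm.apply_toDual_symm_apply (hB := hK)
      (β.comp (rightTriv I (d.1 * d.2⁻¹))) x).symm
  -- By Ad-invariance, K(b, v₁ − Ad_s v₂) = K(b, v₁) − K(Ad_{s⁻¹} b, v₂): this vector represents the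
  -- pulled back covector for the form on 𝔡.
  let w : E × E := (b, adModel I (d.1 * d.2⁻¹)⁻¹ b)
  have hk : ∀ (k : LinearMap.BilinForm ℝ E) (s : G)
      (_ : ∀ x y, k (adModel I s x) (adModel I s y) = k x y) (v : E × E),
      k b (v.1 - adModel I s v.2) = k b v.1 - k (adModel I s⁻¹ b) v.2 := by
    intro k s hk v
    rw [map_sub, ← hk (adModel I s⁻¹ b), adModel_apply_inv]
  have hw : (β.comp (tangentLin (I.prod I) I (fun d : G × G => d.1 * d.2⁻¹) d)).comp
      (rightTriv (I.prod I) d) = doubleForm I K w := LinearMap.ext fun v =>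
    (congrArg β (tangentLin_mul_snd_inv (E := E) d v)).trans ((hb _).trans
      ((hk K _ (hKAd _) v).trans (doubleForm_apply (E := E) K w v).symm))
  refine (twistedBivector_apply (E := E) hσ hK _ β).trans (Eq.symm
    ((congrArg (tangentLin (I.prod I) I _ d) (hT.bivector_apply hw)).trans
    ((tangentLin_mul_snd_inv (E := E) d _).trans (congrArg (rightTriv I _) ?_))))
  exact projMinus_twisted_sub hσ hσσ hT.splitting d b rfl

end Projection

/-! ### The twisted conjugation action and its two differential identities. -/

section TwistedConjugation

open Filter Topology

variable {E H : Type*} [NormedAddCommGroup E] [NormedSpace ℝ E] [TopologicalSpace H]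
  {I : ModelWithCorners ℝ E H} {G : Type*}
  [TopologicalSpace G] [ChartedSpace H G] [Group G] [LieGroup I ∞ G] {σ : G →* G}

lemma infAction_twisted (hσ : ContMDiff I I ∞ σ) (s : G) (x : E) :
    infAction I I (fun g s : G => g * s * (σ g)⁻¹) s x
      = rightTriv I s (x - twistedAd I (mapModel I I σ) s x) := by
  have h := mapModel_twisted (I := I) (I' := I) (α := fun g : G => g) (β := σ) contMDiff_id hσ rfl
    (map_one σ) s x
  rw [mapModel_id] at h
  exact h

variable [FiniteDimensional ℝ E] [I.Boundaryless]
  {K : LinearMap.BilinForm ℝ E} (hK : K.Nondegenerate) (hKs : ∀ x y, K x y = K y x)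
  (hKAd : ∀ (g : G) (x y : E), K (adModel I g x) (adModel I g y) = K x y)
  (hσ : ContMDiff I I ∞ σ) (hσσ : ∀ g, σ (σ g) = g)
  (hσK : ∀ x y : E, K (mapModel I I σ x) (mapModel I I σ y) = K x y)

include hσ in
omit [FiniteDimensional ℝ E] in
lemma alongField_infAction {f : G → ℝ} {s : G} (hf : MDifferentiableAt I 𝓘(ℝ, ℝ) f s) (x : E) :
    alongField I (fun m => infAction I I (fun g s : G => g * s * (σ g)⁻¹) m x) f s
      = dOne I (fun k => f (k * s)) (x - twistedAd I (mapModel I I σ) s x) :=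
  (congrArg (covec I f s) (infAction_twisted hσ s x)).trans (covec_rightTriv hf _)

include hKs hKAd hσ hσσ hσK in
-- The infinitesimal action is 1 − A, whose K-adjoint is 1 − A⁻¹. The arguments of φ_S are therefore
-- the vectors a − A⁻¹ a of `schouten_identity`.
lemma covec_comp_infAction {f : G → ℝ} {s : G} (hf : MDifferentiableAt I 𝓘(ℝ, ℝ) f s) :
    (covec I f s).comp (infAction I I (fun g s : G => g * s * (σ g)⁻¹) s)
      = K (rightGrad I hK f s - twistedAdInv I (mapModel I I σ) s (rightGrad I hK f s)) := by
  have h := isOrthogonalTwist_twistedAd hσ hKs hKAd hσσ hσK s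
  have h1 : ∀ x : E, dOne I (fun k => f (k * s)) (x - twistedAd I (mapModel I I σ) s x)
      = K (rightGrad I hK f s - twistedAdInv I (mapModel I I σ) s (rightGrad I hK f s)) x := by
    intro x
    have h2 := h.adjoint x (rightGrad I hK f s)
    simp only [ContinuousLinearMap.coe_coe] at h2
    rw [← apply_rightGrad hK, map_sub, map_sub, LinearMap.sub_apply,
      hKs _ (twistedAd I (mapModel I I σ) s x), h2, hKs x]
  exact LinearMap.ext fun x => (alongField_infAction hσ hf x).trans (h1 x)

/-- The derivative of `f` along the vector field given by `x`. -/
def twistedAction (I : ModelWithCorners ℝ E H) {K : LinearMap.BilinForm ℝ E} (hK : K.Nondegenerate)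
    (S : E →L[ℝ] E) (x : E) (f : G → ℝ) (s : G) : ℝ :=
  contForm K (rightGrad I hK f s) (x - twistedAd I S s x)

lemma contMDiffAt_twistedAction (S : E →L[ℝ] E) (x : E) {f : G → ℝ} {s : G}
    (hf : ContMDiffAt I 𝓘(ℝ, ℝ) ∞ f s) :
    ContMDiffAt I 𝓘(ℝ, ℝ) ∞ (twistedAction I hK S x f) s :=
  ((contForm K).contDiff.contMDiff.contMDiffAt.comp s (contMDiffAt_rightGrad hK hf)).clm_apply
    (contMDiffAt_const.sub
      ((contMDiff_twistedAd S).contMDiffAt.clm_apply contMDiffAt_const))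

include hσ in
lemma alongField_infAction_eventuallyEq {f : G → ℝ} {U : Set G} {s : G} (hU : IsOpen U)
    (hs : s ∈ U) (hf : ContMDiffOn I 𝓘(ℝ, ℝ) ∞ f U) (x : E) :
    alongField I (fun m => infAction I I (fun g s : G => g * s * (σ g)⁻¹) m x) f =ᶠ[𝓝 s]
      twistedAction I hK (mapModel I I σ) x f := by
  filter_upwards [hU.mem_nhds hs] with t ht
  refine (alongField_infAction hσ
    ((hf.contMDiffAt (hU.mem_nhds ht)).mdifferentiableAt (by simp)) x).trans ?_
  rw [← apply_rightGrad hK]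
  rfl

include hKs hKAd hσ hσσ hσK in
-- The value is 0 because F = 0 for the twisted quasi-triple. Each of the three terms is an explicit
-- derivative at s, and their sum is `lie_identity`.
lemma lieDerivBivector_twisted {f g : G → ℝ} {U : Set G} {s : G} (hU : IsOpen U)
    (hs : s ∈ U) (hf : ContMDiffOn I 𝓘(ℝ, ℝ) ∞ f U) (hg : ContMDiffOn I 𝓘(ℝ, ℝ) ∞ g U) (x : E) :
    lieDerivBivector I (fun m => infAction I I (fun g s : G => g * s * (σ g)⁻¹) m x)
      (twistedBivector (I := I) hK σ) f g s = 0 := by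
  have hfs := hf.contMDiffAt (hU.mem_nhds hs)
  have hgs := hg.contMDiffAt (hU.mem_nhds hs)
  have hev := tensorBracket_eventuallyEq hσ hK hKs hKAd hσσ hσK hU hs hf hg
  have e1 : alongField I (fun m => infAction I I (fun g s : G => g * s * (σ g)⁻¹) m x)
      (tensorBracket I (twistedBivector (I := I) hK σ) f g) s
      = dOne I (fun k => twistedBracket I hK (mapModel I I σ) f g (k * s))
        (x - twistedAd I (mapModel I I σ) s x) := by
    rw [alongField, covec_congr hev]
    exact alongField_infAction hσ
      ((contMDiffAt_twistedBracket hK _ hfs hgs).mdifferentiableAt (by simp)) x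
  rw [lieDerivBivector, e1, tensorBracket, tensorBracket,
    covec_congr (alongField_infAction_eventuallyEq hK hσ hU hs hf x),
    covec_congr (alongField_infAction_eventuallyEq hK hσ hU hs hg x), ← tensorBracket,
    ← tensorBracket, tensorBracket_eq_neg_dOne hσ hK hKs hKAd hσσ hσK
    ((contMDiffAt_twistedAction hK _ x hfs).mdifferentiableAt (by simp))
    (hgs.mdifferentiableAt (by simp)), tensorBracket_eq_dOne hσ hK
    (hfs.mdifferentiableAt (by simp))
    ((contMDiffAt_twistedAction hK _ x hgs).mdifferentiableAt (by simp)),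
    dOne_twistedBracket hK _ hfs hgs (br := lieBilin I G) (fun _ _ => rfl)]
  have e2 := (isOrthogonalTwist_twistedAd hσ hKs hKAd hσσ hσK s).lie_identity (x := x)
    (p := rightHess I hK f s) (q := rightHess I hK g s) (rightHess_sub hK hfs hKs)
    (rightHess_sub hK hgs hKs)
  have e3 := dOne_twistedAction hK (mapModel I I σ) hfs x
    (twistedOp I (mapModel I I σ) s (rightGrad I hK g s))
  have e4 := dOne_twistedAction hK (mapModel I I σ) hgs x
    (twistedOp I (mapModel I I σ) s (rightGrad I hK f s))
  unfold twistedAction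
  rw [e3, e4, sub_neg_eq_add]
  exact e2

include hKs hKAd hσ hσσ hσK in
lemma schoutenBracket_twisted {f g h : G → ℝ} {U : Set G} {s : G} (hU : IsOpen U)
    (hs : s ∈ U) (hf : ContMDiffOn I 𝓘(ℝ, ℝ) ∞ f U) (hg : ContMDiffOn I 𝓘(ℝ, ℝ) ∞ g U)
    (hh : ContMDiffOn I 𝓘(ℝ, ℝ) ∞ h U) {a b c : E}
    (ha : a = rightGrad I hK f s - twistedAdInv I (mapModel I I σ) s (rightGrad I hK f s))
    (hb : b = rightGrad I hK g s - twistedAdInv I (mapModel I I σ) s (rightGrad I hK g s))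
    (hc : c = rightGrad I hK h s - twistedAdInv I (mapModel I I σ) s (rightGrad I hK h s)) :
    (1 / 2 : ℝ) * schoutenBracket I (twistedBivector (I := I) hK σ)
      (twistedBivector (I := I) hK σ) f g h s = (1 / 4 : ℝ) * K c (lieBilin I G a b) := by
  have hfs := hf.contMDiffAt (hU.mem_nhds hs)
  have hgs := hg.contMDiffAt (hU.mem_nhds hs)
  have hhs := hh.contMDiffAt (hU.mem_nhds hs)
  have e := (isOrthogonalTwist_twistedAd hσ hKs hKAd hσσ hσK s).schouten_identity
    (p := rightHess I hK f s) (q := rightHess I hK g s) (r := rightHess I hK h s)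
    (rightHess_sub hK hfs hKs) (rightHess_sub hK hgs hKs) (rightHess_sub hK hhs hKs)
  rw [schoutenBracket, tensorBracket_tensorBracket hσ hK hKs hKAd hσσ hσK hU hs hf hg hh,
    tensorBracket_tensorBracket hσ hK hKs hKAd hσσ hσK hU hs hg hh hf,
    tensorBracket_tensorBracket hσ hK hKs hKAd hσσ hσK hU hs hh hf hg, ha, hb, hc]
  refine Eq.trans ?_ e
  simp only [twistedOp, ContinuousLinearMap.coe_coe]
  ring

end TwistedConjugation

/-! ### The quasi-Poisson property and the orbits. -/

section QuasiPoisson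

variable {E H : Type*} [NormedAddCommGroup E] [NormedSpace ℝ E] [TopologicalSpace H]
  {I : ModelWithCorners ℝ E H} {G : Type*}
  [TopologicalSpace G] [ChartedSpace H G] [Group G] [LieGroup I ∞ G] {σ : G →* G}
  [FiniteDimensional ℝ E] [I.Boundaryless] {K : LinearMap.BilinForm ℝ (GroupLieAlgebra I G)}

lemma isQuasiPoissonAction_twisted (hKs : K.IsSymm) (hK : K.Nondegenerate)
    (hKAd : ∀ (g : G) (x y : GroupLieAlgebra I G), K (Ad I g x) (Ad I g y) = K x y)
    (hσ : ContMDiff I I ∞ σ) (hσσ : ∀ g, σ (σ g) = g)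
    (hσK : ∀ x y : GroupLieAlgebra I G, K (homDeriv I I σ x) (homDeriv I I σ y) = K x y)
    (hT : IsQuasiTriple I (I.prod I) (doubleForm I K) (twistedDiag σ) (gMinus I σ)) :
    IsQuasiPoissonAction I (I.prod I) I hT (fun g s => g * s * (σ g)⁻¹)
      (twistedBivector hK σ) where
  one_act m := by simp
  mul_act g h m := by simp [mul_assoc]
  smooth_act := (contMDiff_fst.mul contMDiff_snd).mul (hσ.comp contMDiff_fst).inv
  isBivectorField := isBivectorField_twistedBivector (E := E) (K := K) hσ hK hKs.eq hKAd hσσ hσK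
  schouten U f g h hU hf hg hh m hm := by
    have hd : ∀ {u : G → ℝ}, ContMDiffOn I 𝓘(ℝ, ℝ) ∞ u U → MDifferentiableAt I 𝓘(ℝ, ℝ) u m :=
      fun hu => (hu.contMDiffAt (hU.mem_nhds hm)).mdifferentiableAt (by simp)
    rw [covec_comp_infAction (E := E) (K := K) hK hKs.eq hKAd hσ hσσ hσK (hd hf),
      covec_comp_infAction (E := E) (K := K) hK hKs.eq hKAd hσ hσσ hσK (hd hg),
      covec_comp_infAction (E := E) (K := K) hK hKs.eq hKAd hσ hσσ hσK (hd hh)]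
    exact (schoutenBracket_twisted (E := E) (K := K) hK hKs.eq hKAd hσ hσσ hσK hU hm hf hg hh
      rfl rfl rfl).trans (phi_twisted (E := E) hσ hσK hT _ _ _).symm
  lieDeriv x U f g hU hf hg m hm := by
    have hd : ∀ {u : G → ℝ}, ContMDiffOn I 𝓘(ℝ, ℝ) ∞ u U → MDifferentiableAt I 𝓘(ℝ, ℝ) u m :=
      fun hu => (hu.contMDiffAt (hU.mem_nhds hm)).mdifferentiableAt (by simp)
    rw [covec_comp_infAction (E := E) (K := K) hK hKs.eq hKAd hσ hσσ hσK (hd hf),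
      covec_comp_infAction (E := E) (K := K) hK hKs.eq hKAd hσ hσσ hσK (hd hg)]
    exact (lieDerivBivector_twisted (E := E) (K := K) hK hKs.eq hKAd hσ hσσ hσK hU hm hf hg
      x).trans (cobracket_twisted (E := E) hσ hσK hT _ _ x).symm

omit [I.Boundaryless] in
lemma range_twistedBivector_le (hK : K.Nondegenerate) (hσ : ContMDiff I I ∞ σ)
    (hσσ : ∀ g, σ (σ g) = g) (s : G) :
    LinearMap.range (twistedBivector hK σ s) ≤
      LinearMap.range (infAction I I (fun g s : G => g * s * (σ g)⁻¹) s) := by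
  rintro _ ⟨α, rfl⟩
  let a : E := (K.toDual hK).symm (α.comp (rightTriv I s))
  have h1 : ∀ a : E, (1 / 2 : ℝ) • (a + twistedAdInv I (mapModel I I σ) s a)
      - twistedAd I (mapModel I I σ) s ((1 / 2 : ℝ) • (a + twistedAdInv I (mapModel I I σ) s a))
      = twistedOp I (mapModel I I σ) s a := by
    intro a
    have h2 : twistedAd I (mapModel I I σ) s (twistedAdInv I (mapModel I I σ) s a) = a := by
      change adModel I s (mapModel I I σ (mapModel I I σ (adModel I s⁻¹ a))) = a
      rw [mapModel_involutive hσ hσσ, adModel_apply_inv]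
    rw [map_smul, map_add, h2, twistedOp]
    module
  -- With x = ½(a + A⁻¹ a), applying 1 − A makes the two copies of ½ a cancel and leaves ½(A⁻¹ − A)
  -- a.
  refine ⟨((1 / 2 : ℝ) • (a + twistedAdInv I (mapModel I I σ) s a) : E), ?_⟩
  exact (infAction_twisted (E := E) hσ s _).trans
    ((congrArg (rightTriv I s) (h1 a)).trans (twistedBivector_apply (E := E) hσ hK s α).symm)

end QuasiPoisson

end

/-! ### The main theorem. -/

theorem mainTheorem1
    {E : Type*} [NormedAddCommGroup E] [NormedSpace ℝ E] [FiniteDimensional ℝ E]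
    {G : Type*} [TopologicalSpace G] [ChartedSpace E G] [Group G] [LieGroup 𝓘(ℝ, E) ∞ G]
    [ConnectedSpace G]
    (K : LinearMap.BilinForm ℝ (GroupLieAlgebra 𝓘(ℝ, E) G))
    (hKsymm : K.IsSymm) (hK : K.Nondegenerate)
    (hKAd : ∀ (g : G) (x y : GroupLieAlgebra 𝓘(ℝ, E) G),
      K (Ad 𝓘(ℝ, E) g x) (Ad 𝓘(ℝ, E) g y) = K x y)
    (σ : G →* G) (hσ : ContMDiff 𝓘(ℝ, E) 𝓘(ℝ, E) ∞ σ) (hσσ : ∀ g, σ (σ g) = g)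
    (hσK : ∀ x y : GroupLieAlgebra 𝓘(ℝ, E) G,
      K (homDeriv 𝓘(ℝ, E) 𝓘(ℝ, E) σ x) (homDeriv 𝓘(ℝ, E) 𝓘(ℝ, E) σ y) = K x y) :
    -- `(D, G_+^σ, 𝔤_-^σ)` is a quasi-triple, and `P_D^σ` is a bivector field on `D`
    ∃ hT : IsQuasiTriple 𝓘(ℝ, E) (𝓘(ℝ, E).prod 𝓘(ℝ, E)) (doubleForm 𝓘(ℝ, E) K) (twistedDiag σ)
        (gMinus 𝓘(ℝ, E) σ),
      IsBivectorField (𝓘(ℝ, E).prod 𝓘(ℝ, E)) hT.bivector ∧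
      -- `(a, b) ↦ a b⁻¹` identifies `S = D / G_+` with `G`
      IsQuotientBy (𝓘(ℝ, E).prod 𝓘(ℝ, E)) 𝓘(ℝ, E) (fun d : G × G => d.1 * d.2⁻¹)
        (twistedDiag (MonoidHom.id G)).range ∧
      -- the left action of `G_+^σ` on `S` is the twisted conjugation action
      (∀ (g : G) (d : G × G), (twistedDiag σ g * d).1 * (twistedDiag σ g * d).2⁻¹
        = g * (d.1 * d.2⁻¹) * (σ g)⁻¹) ∧
      -- `P_D^σ` projects to a unique bivector field `P_S^σ` on `S`
      ∃ PS : TwoTensorField 𝓘(ℝ, E) G,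
        IsBivectorField 𝓘(ℝ, E) PS ∧
        ProjectsTo (𝓘(ℝ, E).prod 𝓘(ℝ, E)) 𝓘(ℝ, E) (fun d : G × G => d.1 * d.2⁻¹)
          hT.bivector PS ∧
        (∀ Q : TwoTensorField 𝓘(ℝ, E) G,
          ProjectsTo (𝓘(ℝ, E).prod 𝓘(ℝ, E)) 𝓘(ℝ, E) (fun d : G × G => d.1 * d.2⁻¹)
            hT.bivector Q → Q = PS) ∧
        -- the formula in the right trivialisation; `α ∘ rightTriv s` is the covector `ξ`
        (∀ (s : G) (α : Module.Dual ℝ (TangentSpace 𝓘(ℝ, E) s)),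
          PS s α = rightTriv 𝓘(ℝ, E) s ((1 / 2 : ℝ) •
            (Ad 𝓘(ℝ, E) (σ s)⁻¹ - Ad 𝓘(ℝ, E) s) (homDeriv 𝓘(ℝ, E) 𝓘(ℝ, E) σ
              ((K.toDual hK).symm (α.comp (rightTriv 𝓘(ℝ, E) s)))))) ∧
        -- the twisted conjugation action is quasi-Poisson
        IsQuasiPoissonAction 𝓘(ℝ, E) (𝓘(ℝ, E).prod 𝓘(ℝ, E)) 𝓘(ℝ, E) hT
          (fun g s => g * s * (σ g)⁻¹) PS ∧
        -- the image of `P_S^σ(s)` is contained in the tangent space at `s` to its orbit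
        (∀ s : G, LinearMap.range (PS s) ≤
          LinearMap.range (infAction 𝓘(ℝ, E) 𝓘(ℝ, E) (fun g s : G => g * s * (σ g)⁻¹) s)) := by
  have hT := isQuasiTriple_twisted hKsymm hK hKAd hσ hσσ hσK
  have hP := projectsTo_twistedBivector hK hσ hσσ hKAd hT
  refine ⟨hT, hT.isBivectorField_bivector, isQuotientBy_mul_snd_inv, fun g d => ?_,
    twistedBivector hK σ,
    isBivectorField_twistedBivector (E := E) (K := K) hσ hK hKsymm.eq hKAd hσσ hσK, hP,
    fun Q hQ => ?_, fun s α => rfl, isQuasiPoissonAction_twisted hKsymm hK hKAd hσ hσσ hσK hT,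
    range_twistedBivector_le hK hσ hσσ⟩
  · change g * d.1 * (σ g * d.2)⁻¹ = _
    simp [mul_assoc]
  · funext s
    -- Projectability prescribes the field at every image point of the quotient map, which is onto;
    -- hence uniqueness.
    obtain ⟨d, rfl⟩ := (isQuotientBy_mul_snd_inv (I := 𝓘(ℝ, E)) (G := G)).surjective s
    exact LinearMap.ext fun β => (hQ d β).trans (hP d β).symm
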